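/- Definitions. Let $m=2\mu$ be even, $0\le k\le\mu$, $\chi$ a real parameter. The basis diagrams of the Temperley–Lieb algebra $\mathrm{TL}_m$ (loop parameter $\chi$) are the non-crossing pairings of $2m$ points, $m$ on a left and $m$ on a right line. An $(m,k)$-link state consists of $m$ points on a line, of which $m-2k$ are joined in pairs by non-crossing arcs and $2k$ are defects (open strands, not covered by any arc). Let $V_k^{(m)}$ be the real vector space with basis the $(m,k)$-link states. The standard module $\pi_k^{(m)}$ of $\mathrm{TL}_m$ on $V^{(m)}_k$ is given by concatenating a diagram with a link state, with a factor $\chi$ for every closed loop, and with result $0$ if the number of defects drops. The trace $\mathrm{Tr}_{\mathrm{TL}_m}$ of a diagram is $\chi^{\ell}$, where $\ell$ is the number of loops obtained by joining opposite points of the two lines. Let $NC_m$ be the set of non-crossing permutations of $\{1,\dots,m\}$ (those whose cycles form a non-crossing partition and run through their elements in increasing cyclic order), and let $\#(h)$ be the number of cycles of $h$, fixed points included. For $h\in NC_m$ draw $1,\dots,m$ in this order around a circle, each with an incoming and, next to it, an outgoing line, and join the outgoing line of $i$ to the incoming line of $h(i)$; cutting the circle so that the $m$ lines of $1,\dots,m/2$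 are on the left and the other $m$ on the right gives a diagram $D(h)$ of $\mathrm{TL}_m$. For $q>0$ put $$M_k^{(m)}(q)=\sum_{h\in NC_m}q^{-\#(h)}\,\pi_k^{(m)}(D(h)).$$ Let $g_{\mu,k}(q)$ be the coefficients of the formal power series $$G(q,r,z)=\frac{1-zC(q,z)}{1-z(q+r)-zC(q,z)}=\sum_{\mu,k\ge0}g_{\mu,k}(q)\,z^\mu r^k,\qquad C(q,z)=\frac{1-z(q-1)-\sqrt{(1+z(q-1))^2-4qz}}{2z},$$ with the square root that is $1$ at $z=0$. Statement. Let $m=2\mu$ with $\mu\ge0$, let $0\le k\le \mu$, let $q_A,q_B>0$ be fixed, and put $q_{AB}=q_Aq_B$, $N(\chi)=M_k^{(m)}(q_A)M_k^{(m)}(q_B)$ and $\Lambda=(q_{AB})^{-k}\bigl(g_{m/2,k}(q_{AB}^{-1})\bigr)^2$. Then $\Lambda\neq0$, and as $\chi\to\infty$: 1. $\chi^{-(m-2k)}N(\chi)$ converges to a matrix of rank one whose only nonzero eigenvalue is $\Lambda$, with algebraic multiplicity one. 2. For all large $\chi$ the matrix $N(\chi)$ has an algebraically simple real eigenvalue $\lambda(\chi)$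 with $$\lambda(\chi)\sim (q_{AB})^{-k}\chi^{m-2k}\bigl(g_{m/2,k}(q_{AB}^{-1})\bigr)^2,$$ and all other (complex) eigenvalues of $N(\chi)$ are $O(\chi^{m-2k-2})$, that is, suppressed by $O(\chi^{-2})$ relative to $\lambda(\chi)$. 3. The multiplicity of the $k$-th sector is asymptotic to $\chi^{2k}$: if, for all large $\chi$, real numbers $d_0(\chi),\dots,d_{\mu}(\chi)$ satisfy $\mathrm{Tr}_{\mathrm{TL}_m}(t)=\sum_{j=0}^{\mu}d_j(\chi)\,\mathrm{tr}\,\pi_j^{(m)}(t)$ for all $t\in \mathrm{TL}_m$, then $d_k(\chi)/\chi^{2k}\to1$. -/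

import Mathlib

open Filter Topology

namespace TL

/-! ### Planar diagrams -/

/-- A system of non-crossing arcs over `n` points on a line with `d` defects. The map `v` exchanges
the two ends of every arc; its fixed points are the defects, which are open strands going off to
infinity, so that no arc may pass over a defect. -/
def IsPlanar {n : ℕ} (d : ℕ) (v : Fin n → Fin n) : Prop :=
  (∀ i, v (v i) = i) ∧
  (∀ i j, i < j → j < v i → i < v j ∧ v j < v i) ∧
  (∀ i j, i < j → j < v i → v j ≠ j) ∧
  (Finset.univ.filter fun i => v i = i).card = d

instance {n d : ℕ} : DecidablePred (IsPlanar (n := n) d) := fun v => by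
  unfold IsPlanar; infer_instance

/-- `(m, k)`-link states: `m` marked points, `2 * k` defects. -/
abbrev LinkState (m k : ℕ) : Type := {v : Fin m → Fin m // IsPlanar (2 * k) v}

/-- The `i`-th point (from the top) on the left line of a diagram with `2 * m` boundary points.
Boundary points are numbered around the diagram: down the left line, then up the right line. -/
def left {m : ℕ} (i : Fin m) : Fin (2 * m) := ⟨i, by omega⟩

/-- The `i`-th point (from the top) on the right line. -/
def right {m : ℕ} (i : Fin m) : Fin (2 * m) := ⟨2 * m - 1 - i, by omega⟩

/-- The basis diagrams of the Temperley-Lieb algebra `TL_m`: the `2 * m` boundary points are joined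
in pairs by non-crossing strands. -/
abbrev Diagram (m : ℕ) : Type := {D : Fin (2 * m) → Fin (2 * m) // IsPlanar 0 D}

/-! ### The standard modules and the trace -/

/-- The diagram `D` with the link state `v` attached to its right line. -/
def glue {m : ℕ} (D : Fin (2 * m) → Fin (2 * m)) (v : Fin m → Fin m) :
    SimpleGraph (Fin (2 * m)) :=
  SimpleGraph.fromRel fun a b => D a = b ∨ ∃ i, a = right i ∧ b = right (v i)

/-- The number of closed loops in `glue D v`: the connected components which reach neither the left
line nor a defect of `v`. -/
noncomputable def loops {m : ℕ} (D : Fin (2 * m) → Fin (2 * m)) (v : Fin m → Fin m) : ℕ :=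
  {c : (glue D v).ConnectedComponent |
    ∀ a, (glue D v).connectedComponentMk a = c → ∃ i, a = right i ∧ v i ≠ i}.ncard

/-- `x` is what is left of `glue D v` after removal of the closed loops: the arcs of `x` are the
strands joining two points of the left line, and its defects are the strands joining a point of the
left line to a defect of `v`. For `x` and `v` with equally many defects this excludes that two
defects of `v` are joined to each other. -/
def IsResult {m : ℕ} (D : Fin (2 * m) → Fin (2 * m)) (v x : Fin m → Fin m) : Prop :=
  ∀ i, (x i = i → ∃ j, v j = j ∧ (glue D v).Reachable (left i) (right j)) ∧
    (x i ≠ i → (glue D v).Reachable (left i) (left (x i)))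

open Classical in
/-- The matrix of the diagram `D` in the standard module spanned by the `(m, k)`-link states. Column
`y` holds the coefficients of `D` acting on `y`: the concatenated link state, with a factor `χ` for
every closed loop, or zero if the number of defects drops. -/
noncomputable def stdRep {m : ℕ} (k : ℕ) (χ : ℝ) (D : Fin (2 * m) → Fin (2 * m)) :
    Matrix (LinkState m k) (LinkState m k) ℝ :=
  Matrix.of fun x y => if IsResult D y.1 x.1 then χ ^ loops D y.1 else 0

/-- The diagram `D` with opposite ends `left i` and `right i` joined. -/
def closure {m : ℕ} (D : Fin (2 * m) → Fin (2 * m)) : SimpleGraph (Fin (2 * m)) :=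
  SimpleGraph.fromRel fun a b => D a = b ∨ ∃ i, a = left i ∧ b = right i

/-- The trace of the Temperley-Lieb algebra on basis diagrams: a factor `χ` for every loop of the
closure. -/
noncomputable def diagramTrace {m : ℕ} (χ : ℝ) (D : Fin (2 * m) → Fin (2 * m)) : ℝ :=
  χ ^ Nat.card (closure D).ConnectedComponent

/-- `d 0, …, d (m / 2)` are multiplicities of the standard modules for which the matrix trace on
`⨁ k, d k • V_k` is the trace of `TL_m` (it suffices to say so on basis diagrams). -/
def IsMultiplicity (m : ℕ) (χ : ℝ) (d : ℕ → ℝ) : Prop :=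
  ∀ D : Diagram m,
    diagramTrace χ D.1 = ∑ k ∈ Finset.range (m / 2 + 1), d k * (stdRep k χ D.1).trace

/-! ### Non-crossing permutations -/

/-- Non-crossing permutations: the cycles form a non-crossing partition, and each cycle runs through
its elements in increasing order and then returns from the largest one to the smallest one. -/
def IsNoncrossing {m : ℕ} (h : Equiv.Perm (Fin m)) : Prop :=
  (∀ a b c d, a < b → b < c → c < d → h.SameCycle a c → h.SameCycle b d → h.SameCycle a b) ∧
  (∀ i j, h.SameCycle i j → i < h i → j ≤ i ∨ h i ≤ j) ∧
  (∀ i j, h.SameCycle i j → h i ≤ i → h i ≤ j ∧ j ≤ i)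

/-- The number of cycles of `h`, trivial ones included. -/
noncomputable def numCycles {m : ℕ} (h : Equiv.Perm (Fin m)) : ℕ :=
  Nat.card (Quotient (Equiv.Perm.SameCycle.setoid h))

/-- The diagram `D(h)`, in double line notation: the element `i` carries an incoming line `2 * i` and
an outgoing line `2 * i + 1`, and the outgoing line of `i` is the incoming line of `h i`. For even
`m` the elements of the first half give the left line and the others the right line. -/
def doubleLine {m : ℕ} (h : Equiv.Perm (Fin m)) (a : Fin (2 * m)) : Fin (2 * m) :=
  if a.1 % 2 = 1 then ⟨2 * h ⟨a / 2, by omega⟩, by omega⟩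
  else ⟨2 * h.symm ⟨a / 2, by omega⟩ + 1, by omega⟩

open Classical in
/-- `M_k^{(m)}(q) = ∑_{h ∈ NC_m} q^{-#(h)} π_k^{(m)}(D(h))`. -/
noncomputable def M (m k : ℕ) (χ q : ℝ) : Matrix (LinkState m k) (LinkState m k) ℝ :=
  ∑ h : Equiv.Perm (Fin m) with IsNoncrossing h,
    (q⁻¹ ^ numCycles h) • stdRep k χ (doubleLine h)

/-! ### The generating function -/

/-- The power series `√((1 + z (q - 1))² - 4 q z)` with constant coefficient `1`, as the binomial
series `(1 + w) ^ (1 / 2)` at `w = (1 + z (q - 1))² - 4 q z - 1`. -/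
noncomputable def sqrtSeries (q : ℝ) : PowerSeries ℝ :=
  (PowerSeries.binomialSeries ℝ (1 / 2 : ℝ)).subst
    ((1 + PowerSeries.X * PowerSeries.C (q - 1)) ^ 2 - PowerSeries.C (4 * q) * PowerSeries.X - 1 :
      PowerSeries ℝ)

lemma hasSubst_sqrt (q : ℝ) : PowerSeries.HasSubst
    ((1 + PowerSeries.X * PowerSeries.C (q - 1)) ^ 2 - PowerSeries.C (4 * q) * PowerSeries.X - 1 :
      PowerSeries ℝ) :=
  PowerSeries.HasSubst.of_constantCoeff_zero' (by simp)

lemma sqrtSeries_sq (q : ℝ) : sqrtSeries q ^ 2 =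
    (1 + PowerSeries.X * PowerSeries.C (q - 1)) ^ 2 - PowerSeries.C (4 * q) * PowerSeries.X := by
  have h : PowerSeries.binomialSeries ℝ (1 / 2 : ℝ) * PowerSeries.binomialSeries ℝ (1 / 2 : ℝ)
      = 1 + PowerSeries.X := by
    rw [← PowerSeries.binomialSeries_add]
    have := PowerSeries.binomialSeries_nat (R := ℝ) (A := ℝ) 1
    norm_num at this ⊢
    exact this
  rw [sq, sqrtSeries, ← PowerSeries.subst_mul (hasSubst_sqrt q), h,
    PowerSeries.subst_add (hasSubst_sqrt q), PowerSeries.subst_X (hasSubst_sqrt q),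
    ← PowerSeries.coe_substAlgHom (hasSubst_sqrt q), map_one]
  ring

lemma constantCoeff_sqrtSeries (q : ℝ) : PowerSeries.constantCoeff (sqrtSeries q) = 1 := by
  have h : PowerSeries.binomialSeries ℝ (1 / 2 : ℝ) =
      1 + (PowerSeries.binomialSeries ℝ (1 / 2 : ℝ) - 1) := by ring
  have h0 := PowerSeries.constantCoeff_subst_eq_zero
    (a := ((1 + PowerSeries.X * PowerSeries.C (q - 1)) ^ 2 - PowerSeries.C (4 * q) * PowerSeries.X - 1 :
      PowerSeries ℝ)) (show PowerSeries.constantCoeff _ = 0 by simp)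
    (PowerSeries.binomialSeries ℝ (1 / 2 : ℝ) - 1) (by simp)
  rw [sqrtSeries, h, PowerSeries.subst_add (hasSubst_sqrt q),
    ← PowerSeries.coe_substAlgHom (hasSubst_sqrt q), map_one,
    PowerSeries.coe_substAlgHom (hasSubst_sqrt q), map_add]
  have h1 : PowerSeries.constantCoeff (R := ℝ) 1 = 1 := by simp
  rw [h1]
  exact (congrArg (1 + ·) h0).trans (by simp)

/-- `C(q, z) = (1 - z (q - 1) - √((1 + z (q - 1))² - 4 q z)) / (2 z)`; the numerator has constant
coefficient `0`, and division by `z` is a shift of the coefficients. -/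
noncomputable def catalanSeries (q : ℝ) : PowerSeries ℝ :=
  PowerSeries.mk fun n =>
    PowerSeries.coeff (n + 1) (1 - PowerSeries.X * PowerSeries.C (q - 1) - sqrtSeries q) / 2

/-- `G(q, r, z) = (1 - z C(q, z)) / (1 - z (q + r) - z C(q, z))` as a power series in `z` whose
coefficients are polynomials in `r`; the denominator has constant coefficient `1`. -/
noncomputable def G (q : ℝ) : PowerSeries (Polynomial ℝ) :=
  let zC : PowerSeries (Polynomial ℝ) :=
    PowerSeries.X * PowerSeries.map Polynomial.C (catalanSeries q)
  (1 - zC) * PowerSeries.invOfUnit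
    (1 - PowerSeries.X * PowerSeries.C (Polynomial.C q + Polynomial.X) - zC) 1

/-- The coefficient `g_{μ,k}(q)` of `z ^ μ r ^ k` in `G(q, r, z)`. -/
noncomputable def g (μ k : ℕ) (q : ℝ) : ℝ :=
  (PowerSeries.coeff μ (G q)).coeff k

end TL

/-!
Call the number of arcs of a link state `x` that end at an odd position its weight `a(x)`
(`TL.oddClosings`); it counts the shaded regions cut off by arcs of `x` in the chessboard
colouring in which the cycles of `h` are the shaded regions of the diagram `D(h)`.

*Leading order of `M`.* Gluing a diagram `D` to a link state `y` with `μ - k` arcs gives at most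
`μ - k` loops, as every loop uses an arc of `y`, and there are `μ - k` of them only if `D`
contains the mirror image of every arc of `y` (`TL.isResult_and_loops_iff_joins`). Hence the entry
`(x, y)` of `M` is of order `χ ^ (μ - k)`, and its leading coefficient comes from the diagrams
that join the half `x` to the half `y`. Non-crossing permutations are the same as planar diagrams
(`TL.isPlanar_doubleLine`, `TL.isNoncrossing_of_isPlanar`), and as through strands do not cross
there is precisely one such diagram `|x⟩⟨y|` (`TL.existsUnique_noncrossing_joins`). Its
permutation has `k + a(x) + a(y)` cycles (`TL.Joins.numCycles_eq`), so the leading term of `M` is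
the rank one matrix `q⁻ᵏ u uᵀ` with `u x = q ^ (-a(x))`.

*Spectrum of `N`.* The product of two such leading terms is again of rank one, with eigenvalue
`(q_A q_B)⁻ᵏ (∑ₓ (q_A q_B) ^ (-a(x)))²`. The sum is `g_{μ,k}`: removal of the last point of a link
state gives a recursion in the numbers of points and defects, and two steps of it give the
recursion that the functional equation of `G` gives for its coefficients
(`TL.sum_linkState_eq_g`). Perturbation theory gives the simple eigenvalue. The others are
suppressed by `χ⁻²` rather than `χ⁻¹`, because *both* factors are of rank one up to order `χ⁻¹`:
on the complement of the leading eigenvector the first order term vanishes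
(`TL.spectrum_of_rank_one_perturbation`).

*Multiplicities.* On `|x⟩⟨x|` with `2 j` through strands the trace is `χ ^ (μ + j)`, the character
of the `j`-th standard module is `χ ^ (μ - j)`, those of the later ones vanish, and those of the
earlier ones are `O(χ ^ (μ - j))`. This triangular system is solved by induction
(`TL.tendsto_multiplicity`).
-/

namespace TL

/-! ### The functional equation of `G` -/

lemma two_X_mul_catalanSeries (q : ℝ) :
    PowerSeries.C (2 : ℝ) * (PowerSeries.X * catalanSeries q) =
      1 - PowerSeries.X * PowerSeries.C (q - 1) - sqrtSeries q := by
  ext n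
  rcases n with _ | n
  · simp [constantCoeff_sqrtSeries]
  · rw [PowerSeries.coeff_C_mul, PowerSeries.coeff_succ_X_mul, catalanSeries,
      PowerSeries.coeff_mk]
    ring

/-- The quadratic equation of which `catalanSeries q` is the power series solution. -/
lemma catalanSeries_eq (q : ℝ) :
    catalanSeries q =
      1 + PowerSeries.X * catalanSeries q * (catalanSeries q - 1 + PowerSeries.C q) := by
  have h := two_X_mul_catalanSeries q
  have h2 := sqrtSeries_sq q
  have hs : sqrtSeries q = 1 - PowerSeries.X * PowerSeries.C (q - 1) -
      PowerSeries.C (2 : ℝ) * (PowerSeries.X * catalanSeries q) := by rw [h]; ring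
  rw [hs] at h2
  have h4 : (PowerSeries.C (2 : ℝ)) = 2 := map_ofNat _ 2
  have h5 : (PowerSeries.C (q - 1)) = PowerSeries.C q - 1 := by simp
  have h6 : (PowerSeries.C (4 * q)) = 4 * PowerSeries.C q := by rw [map_mul, map_ofNat]
  rw [h4, h5, h6] at h2
  have h7 : (4 * PowerSeries.X : PowerSeries ℝ) * (catalanSeries q) = 4 * PowerSeries.X *
      (1 + PowerSeries.X * catalanSeries q * (catalanSeries q - 1 + PowerSeries.C q)) := by
    linear_combination -h2
  have h8 : (4 * PowerSeries.X : PowerSeries ℝ) ≠ 0 := by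
    have : (4 : PowerSeries ℝ) ≠ 0 := by
      intro h
      have := congrArg PowerSeries.constantCoeff h
      rw [show (4 : PowerSeries ℝ) = PowerSeries.C 4 from (map_ofNat _ 4).symm] at this
      simp at this
    exact mul_ne_zero this PowerSeries.X_ne_zero
  exact mul_left_cancel₀ h8 h7

/-- The kernel form of the functional equation of `G`: it encodes how the coefficients of
`z ^ (μ + 1)` arise from those of `z ^ μ`. -/
lemma G_functional_eq (q : ℝ) :
    PowerSeries.C Polynomial.X * G q -
      PowerSeries.X * (PowerSeries.C ((Polynomial.X + 1) * (Polynomial.X + Polynomial.C q)) * G q) =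
    PowerSeries.C Polynomial.X -
      PowerSeries.X * (PowerSeries.C (Polynomial.X + Polynomial.C q) *
        PowerSeries.map Polynomial.C (catalanSeries q)) := by
  set c := PowerSeries.map Polynomial.C (catalanSeries q) with hc
  have hcat : c = 1 + PowerSeries.X * c * (c - 1 + PowerSeries.C (Polynomial.C q)) := by
    have := congrArg (PowerSeries.map (Polynomial.C : ℝ →+* _)) (catalanSeries_eq q)
    simpa using this
  set r : PowerSeries (Polynomial ℝ) := PowerSeries.C Polynomial.X
  set Q : PowerSeries (Polynomial ℝ) := PowerSeries.C (Polynomial.C q)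
  set z : PowerSeries (Polynomial ℝ) := PowerSeries.X
  have hG : G q * (1 - z * (Q + r) - z * c) = 1 - z * c := by
    have h1 : (1 - z * PowerSeries.C (Polynomial.C q + Polynomial.X) - z * c) *
        PowerSeries.invOfUnit (1 - z * PowerSeries.C (Polynomial.C q + Polynomial.X) - z * c) 1 =
          1 :=
      PowerSeries.mul_invOfUnit _ _ (by simp [z])
    have h2 : PowerSeries.C (Polynomial.C q + Polynomial.X) = Q + r := by simp [Q, r]
    have h3 : G q = (1 - z * c) *
      PowerSeries.invOfUnit (1 - z * PowerSeries.C (Polynomial.C q + Polynomial.X) - z * c) 1 := rfl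
    rw [h2] at h1 h3
    rw [h3]
    linear_combination (1 - z * c) * h1
  have hne : (1 - z * (Q + r) - z * c) ≠ 0 := by
    intro h
    have := congrArg PowerSeries.constantCoeff h
    simp [z] at this
  have e1 : PowerSeries.C ((Polynomial.X + 1) * (Polynomial.X + Polynomial.C q)) =
    (r + 1) * (r + Q) := by simp [Q, r]
  have e2 : PowerSeries.C (Polynomial.X + Polynomial.C q) = r + Q := by simp [Q, r]
  rw [e1, e2]
  refine mul_right_cancel₀ hne ?_
  linear_combination (r - z * ((r + 1) * (r + Q))) * hG + z * (r + Q) * hcat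

lemma g_zero (k : ℕ) (q : ℝ) : g 0 k q = if k = 0 then 1 else 0 := by
  have h : PowerSeries.coeff 0 (G q) = 1 := by
    simp [G, PowerSeries.constantCoeff_invOfUnit]
  rw [g, h, Polynomial.coeff_one]

lemma coeff_G_functional_eq (μ k : ℕ) (q : ℝ) :
    (Polynomial.X * PowerSeries.coeff (μ + 1) (G q)).coeff k -
      (((Polynomial.X + 1) * (Polynomial.X + Polynomial.C q)) * PowerSeries.coeff μ (G q)).coeff k =
    - ((Polynomial.X + Polynomial.C q) *
        Polynomial.C (PowerSeries.coeff μ (catalanSeries q))).coeff k := by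
  have h := congrArg (fun F => (PowerSeries.coeff (μ + 1) F).coeff k) (G_functional_eq q)
  simp only [map_sub, PowerSeries.coeff_C_mul, PowerSeries.coeff_succ_X_mul, PowerSeries.coeff_map,
    Polynomial.coeff_sub] at h
  rw [h]
  simp

lemma g_zero_right (μ : ℕ) {q : ℝ} (hq : q ≠ 0) :
    g μ 0 q = PowerSeries.coeff μ (catalanSeries q) := by
  have h := coeff_G_functional_eq μ 0 q
  simp [Polynomial.mul_coeff_zero] at h
  exact h.resolve_right hq

lemma g_succ_succ (μ k : ℕ) (q : ℝ) :
    g (μ + 1) (k + 1) q = g μ k q + (1 + q) * g μ (k + 1) q + q * g μ (k + 2) q := by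
  have h := coeff_G_functional_eq μ (k + 2) q
  have e : ((Polynomial.X + 1) * (Polynomial.X + Polynomial.C q)) * PowerSeries.coeff μ (G q) =
    Polynomial.X * (Polynomial.X * PowerSeries.coeff μ (G q)) +
    Polynomial.C (1 + q) * (Polynomial.X * PowerSeries.coeff μ (G q)) +
      Polynomial.C q * PowerSeries.coeff μ (G q) := by simp; ring
  rw [e] at h
  simp only [add_mul, Polynomial.coeff_add, Polynomial.coeff_X_mul, Polynomial.coeff_C_mul,
    Polynomial.coeff_C_succ] at h
  rw [g, g, g, g]
  linarith

lemma g_succ_zero (μ : ℕ) {q : ℝ} (hq : q ≠ 0) :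
    g (μ + 1) 0 q = q * g μ 0 q + q * g μ 1 q := by
  have h := coeff_G_functional_eq μ 1 q
  have e : ((Polynomial.X + 1) * (Polynomial.X + Polynomial.C q)) * PowerSeries.coeff μ (G q) =
    Polynomial.X * (Polynomial.X * PowerSeries.coeff μ (G q)) +
    Polynomial.C (1 + q) * (Polynomial.X * PowerSeries.coeff μ (G q)) +
      Polynomial.C q * PowerSeries.coeff μ (G q) := by simp; ring
  have e2 : (Polynomial.X * (Polynomial.X * PowerSeries.coeff μ (G q))).coeff 1 = 0 := by
    rw [show 1 = 0 + 1 from rfl, Polynomial.coeff_X_mul, Polynomial.mul_coeff_zero]; simp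
  have e3 (p : Polynomial ℝ) : (Polynomial.X * p).coeff 1 = p.coeff 0 := Polynomial.coeff_X_mul p 0
  rw [e] at h
  simp only [add_mul, Polynomial.coeff_add, e2, e3, Polynomial.coeff_C_mul,
    Polynomial.coeff_C_zero, Polynomial.coeff_C_succ] at h
  rw [← g_zero_right μ hq] at h
  simp only [g] at h ⊢
  linarith

/-! ### Counting link states -/

/-- The number of arcs of `v` whose right end has odd position. In the shading of the regions
that colours the gap between the points `2 * i` and `2 * i + 1`, this is the number of shaded
regions that are cut off by arcs. -/
def oddClosings {n : ℕ} (v : Fin n → Fin n) : ℕ :=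
  (Finset.univ.filter fun i => i.1 % 2 = 1 ∧ v i < i).card

/-- The generating polynomial of planar arc systems on `n` points with `d` defects. -/
def planarSum (Q : ℝ) (n d : ℕ) : ℝ :=
  ∑ v : Fin n → Fin n with IsPlanar d v, Q ^ oddClosings v

lemma IsPlanar.injective {n d : ℕ} {v : Fin n → Fin n} (hv : IsPlanar d v) :
    Function.Injective v := Function.LeftInverse.injective hv.1

lemma IsPlanar.sum_fixed {n d : ℕ} {v : Fin n → Fin n} (hv : IsPlanar d v) :
    ∑ i, (if v i = i then 1 else 0) = d := by
  rw [← Finset.card_filter]; exact hv.2.2.2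

/-- Removal of the last point; its partner, if there is one, becomes a defect. -/
def dropLast {n : ℕ} (v : Fin (n + 1) → Fin (n + 1)) (i : Fin n) : Fin n :=
  if h : v i.castSucc = Fin.last n then i else (v i.castSucc).castPred h

lemma dropLast_of_eq {n : ℕ} {v : Fin (n + 1) → Fin (n + 1)} {i : Fin n}
    (h : v i.castSucc = Fin.last n) : dropLast v i = i := by simp [dropLast, h]

lemma castSucc_dropLast {n : ℕ} {v : Fin (n + 1) → Fin (n + 1)} {i : Fin n}
    (h : v i.castSucc ≠ Fin.last n) : (dropLast v i).castSucc = v i.castSucc := by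
  simp [dropLast, h]

/-- Addition of a defect after the last point. -/
def snocDefect {n : ℕ} (v : Fin n → Fin n) : Fin (n + 1) → Fin (n + 1) :=
  Fin.lastCases (Fin.last n) fun i => (v i).castSucc

/-- Addition of a point after the last one, joined to `p`. -/
def snocArc {n : ℕ} (p : Fin n) (v : Fin n → Fin n) : Fin (n + 1) → Fin (n + 1) :=
  Fin.lastCases p.castSucc fun i => if i = p then Fin.last n else (v i).castSucc

@[simp] lemma snocDefect_last {n : ℕ} (v : Fin n → Fin n) :
    snocDefect v (Fin.last n) = Fin.last n := by simp [snocDefect]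

@[simp] lemma snocDefect_castSucc {n : ℕ} (v : Fin n → Fin n) (i : Fin n) :
    snocDefect v i.castSucc = (v i).castSucc := by simp [snocDefect]

@[simp] lemma snocArc_last {n : ℕ} (p : Fin n) (v : Fin n → Fin n) :
    snocArc p v (Fin.last n) = p.castSucc := by simp [snocArc]

@[simp] lemma snocArc_castSucc {n : ℕ} (p : Fin n) (v : Fin n → Fin n) (i : Fin n) :
    snocArc p v i.castSucc = if i = p then Fin.last n else (v i).castSucc := by simp [snocArc]

lemma IsPlanar.dropLast_conditions {n d : ℕ} {v : Fin (n + 1) → Fin (n + 1)} (hv : IsPlanar d v) :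
    (∀ i, dropLast v (dropLast v i) = i) ∧
    (∀ i j, i < j → j < dropLast v i → i < dropLast v j ∧ dropLast v j < dropLast v i) ∧
    (∀ i j, i < j → j < dropLast v i → dropLast v j ≠ j) := by
  have key : ∀ i j, i < j → j < dropLast v i →
      v i.castSucc ≠ Fin.last n ∧ v j.castSucc ≠ Fin.last n ∧ i.castSucc < j.castSucc ∧
        j.castSucc < v i.castSucc := by
    intro i j hij hj
    have h1 : v i.castSucc ≠ Fin.last n := by
      intro h; rw [dropLast_of_eq h] at hj; exact lt_asymm hij hj
    have h3 : j.castSucc < v i.castSucc := by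
      rw [← castSucc_dropLast h1]; exact Fin.castSucc_lt_castSucc_iff.2 hj
    have h2 := hv.2.1 _ _ (Fin.castSucc_lt_castSucc_iff.2 hij) h3
    exact ⟨h1, (h2.2.trans_le (Fin.le_last _)).ne, Fin.castSucc_lt_castSucc_iff.2 hij, h3⟩
  refine ⟨fun i => ?_, fun i j hij hj => ?_, fun i j hij hj => ?_⟩
  · by_cases h : v i.castSucc = Fin.last n
    · rw [dropLast_of_eq h, dropLast_of_eq h]
    · apply Fin.castSucc_injective
      have h1 : v (dropLast v i).castSucc = i.castSucc := by rw [castSucc_dropLast h, hv.1]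
      rw [castSucc_dropLast (h1 ▸ (Fin.castSucc_lt_last i).ne), h1]
  · obtain ⟨h1, h2, h3, h4⟩ := key i j hij hj
    have := hv.2.1 _ _ h3 h4
    rwa [← castSucc_dropLast h1, ← castSucc_dropLast h2, Fin.castSucc_lt_castSucc_iff,
      Fin.castSucc_lt_castSucc_iff] at this
  · obtain ⟨h1, h2, h3, h4⟩ := key i j hij hj
    have := hv.2.2.1 _ _ h3 h4
    rw [← castSucc_dropLast h2] at this
    exact fun h => this (by rw [h])

lemma IsPlanar.dropLast_of_defect {n d : ℕ} {v : Fin (n + 1) → Fin (n + 1)}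
    (hv : IsPlanar (d + 1) v) (hl : v (Fin.last n) = Fin.last n) : IsPlanar d (dropLast v) := by
  obtain ⟨h1, h2, h3⟩ := hv.dropLast_conditions
  refine ⟨h1, h2, h3, ?_⟩
  have h := hv.sum_fixed
  rw [Fin.sum_univ_castSucc, if_pos hl] at h
  rw [Finset.card_filter, ← Nat.succ_inj, Nat.succ_eq_add_one, Nat.succ_eq_add_one, ← h]
  congr 1
  refine Finset.sum_congr rfl fun i _ => ?_
  have hne : v i.castSucc ≠ Fin.last n := fun h =>
    (Fin.castSucc_lt_last i).ne (hv.injective (h.trans hl.symm))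
  simp only [← castSucc_dropLast hne, Fin.castSucc_inj]

lemma IsPlanar.dropLast_of_arc {n d : ℕ} {v : Fin (n + 1) → Fin (n + 1)}
    (hv : IsPlanar d v) (hl : v (Fin.last n) ≠ Fin.last n) : IsPlanar (d + 1) (dropLast v) := by
  obtain ⟨h1, h2, h3⟩ := hv.dropLast_conditions
  refine ⟨h1, h2, h3, ?_⟩
  have h := hv.sum_fixed
  rw [Fin.sum_univ_castSucc, if_neg hl, add_zero] at h
  obtain ⟨p, hp⟩ := Fin.exists_castSucc_eq.2 hl
  have e : ∀ i : Fin n, (if dropLast v i = i then 1 else 0) =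
      (if v i.castSucc = i.castSucc then 1 else 0) + if i = p then 1 else 0 := by
    intro i
    by_cases hi : v i.castSucc = Fin.last n
    · have : i = p := by
        apply Fin.castSucc_injective
        rw [hp, ← hi, hv.1]
      rw [dropLast_of_eq hi, if_pos rfl, if_pos this, hi, if_neg (Fin.castSucc_lt_last i).ne']
    · have : i ≠ p := by
        rintro rfl
        exact hi (by rw [hp, hv.1])
      simp only [← castSucc_dropLast hi, Fin.castSucc_inj, if_neg this, add_zero]
  rw [Finset.card_filter, Finset.sum_congr rfl fun i _ => e i, Finset.sum_add_distrib, h]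
  simp

lemma IsPlanar.snocDefect {n d : ℕ} {v : Fin n → Fin n} (hv : IsPlanar d v) :
    IsPlanar (d + 1) (snocDefect v) := by
  refine ⟨fun i => ?_, fun i j hij hj => ?_, fun i j hij hj => ?_, ?_⟩
  · induction i using Fin.lastCases <;> simp [hv.1]
  · induction i using Fin.lastCases with
    | last => exact absurd hij (Fin.le_last _).not_gt
    | cast i =>
      induction j using Fin.lastCases with
      | last => exact absurd hj (Fin.le_last _).not_gt
      | cast j =>
        simp only [snocDefect_castSucc, Fin.castSucc_lt_castSucc_iff] at *
        exact hv.2.1 _ _ hij hj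
  · induction i using Fin.lastCases with
    | last => exact absurd hij (Fin.le_last _).not_gt
    | cast i =>
      induction j using Fin.lastCases with
      | last => exact absurd hj (Fin.le_last _).not_gt
      | cast j =>
        simp only [snocDefect_castSucc, Fin.castSucc_lt_castSucc_iff, ne_eq, Fin.castSucc_inj] at *
        exact hv.2.2.1 _ _ hij hj
  · rw [Finset.card_filter, Fin.sum_univ_castSucc]
    simpa using hv.2.2.2

/-- The new arc ends at the last defect, so it crosses no arc and covers no defect. -/
lemma IsPlanar.snocArc {n d : ℕ} {v : Fin n → Fin n} (hv : IsPlanar (d + 1) v) {p : Fin n}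
    (hp : v p = p) (hmax : ∀ i, v i = i → i ≤ p) : IsPlanar d (snocArc p v) := by
  have hinj := hv.injective
  have key : ∀ i j : Fin n, i < j → j.castSucc < TL.snocArc p v i.castSucc →
      j ≠ p ∧ i < v j ∧ (i ≠ p → v j < v i) ∧ v j ≠ j := by
    intro i j hij hj
    rw [snocArc_castSucc] at hj
    split_ifs at hj with hi
    · subst hi
      have hvj : v j ≠ j := fun h => absurd (hmax j h) hij.not_ge
      refine ⟨hij.ne', ?_, fun h => absurd rfl h, hvj⟩
      by_contra hlt
      have h1 : v j ≠ i := fun h => hij.ne' (hinj (h.trans hp.symm))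
      exact hv.2.2.1 (v j) i (lt_of_le_of_ne (not_lt.1 hlt) h1) (by rwa [hv.1]) hp
    · rw [Fin.castSucc_lt_castSucc_iff] at hj
      have hc := hv.2.2.1 _ _ hij hj
      have hx := hv.2.1 _ _ hij hj
      exact ⟨fun h => hc (by rw [h, hp]), hx.1, fun _ => hx.2, hc⟩
  refine ⟨fun i => ?_, fun i j hij hj => ?_, fun i j hij hj => ?_, ?_⟩
  · induction i using Fin.lastCases with
    | last => simp
    | cast i =>
      by_cases hi : i = p
      · simp [hi]
      · have : v i ≠ p := fun h => hi (hinj (h.trans hp.symm))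
        simp [hi, this, hv.1]
  · induction i using Fin.lastCases with
    | last => exact absurd hij (Fin.le_last _).not_gt
    | cast i =>
      induction j using Fin.lastCases with
      | last => exact absurd hj (Fin.le_last _).not_gt
      | cast j =>
        obtain ⟨h1, h2, h3, h4⟩ := key i j (Fin.castSucc_lt_castSucc_iff.1 hij) hj
        rw [snocArc_castSucc, if_neg h1, snocArc_castSucc]
        refine ⟨Fin.castSucc_lt_castSucc_iff.2 h2, ?_⟩
        split_ifs with hi
        · exact Fin.castSucc_lt_last _
        · exact Fin.castSucc_lt_castSucc_iff.2 (h3 hi)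
  · induction i using Fin.lastCases with
    | last => exact absurd hij (Fin.le_last _).not_gt
    | cast i =>
      induction j using Fin.lastCases with
      | last => exact absurd hj (Fin.le_last _).not_gt
      | cast j =>
        obtain ⟨h1, h2, h3, h4⟩ := key i j (Fin.castSucc_lt_castSucc_iff.1 hij) hj
        rw [snocArc_castSucc, if_neg h1]
        exact fun h => h4 (Fin.castSucc_injective _ h)
  · have h := hv.sum_fixed
    have e : ∀ i : Fin n, (if v i = i then 1 else 0) =
        (if TL.snocArc p v i.castSucc = i.castSucc then 1 else 0) + if i = p then 1 else 0 := by
      intro i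
      by_cases hi : i = p
      · subst hi
        simp [hp, (Fin.castSucc_lt_last i).ne']
      · simp [hi]
    rw [Finset.sum_congr rfl fun i _ => e i, Finset.sum_add_distrib] at h
    rw [Finset.card_filter, Fin.sum_univ_castSucc]
    simpa [(Fin.castSucc_lt_last p).ne] using h

lemma dropLast_snocDefect {n : ℕ} (v : Fin n → Fin n) : dropLast (snocDefect v) = v := by
  funext i
  apply Fin.castSucc_injective
  rw [castSucc_dropLast] <;> simp [(Fin.castSucc_lt_last _).ne]

lemma snocDefect_dropLast {n d : ℕ} {v : Fin (n + 1) → Fin (n + 1)} (hv : IsPlanar d v)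
    (hl : v (Fin.last n) = Fin.last n) : snocDefect (dropLast v) = v := by
  funext i
  induction i using Fin.lastCases with
  | last => simp [hl]
  | cast i =>
    have hne : v i.castSucc ≠ Fin.last n := fun h =>
      (Fin.castSucc_lt_last i).ne (hv.injective (h.trans hl.symm))
    rw [snocDefect_castSucc, castSucc_dropLast hne]

lemma dropLast_snocArc {n : ℕ} {v : Fin n → Fin n} {p : Fin n} (hp : v p = p) :
    dropLast (snocArc p v) = v := by
  funext i
  by_cases hi : i = p
  · subst hi
    rw [dropLast_of_eq (by simp), hp]
  · apply Fin.castSucc_injective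
    rw [castSucc_dropLast] <;> simp [hi, (Fin.castSucc_lt_last _).ne]

/-- The partner of the last point becomes the last defect. -/
lemma IsPlanar.exists_snocArc {n d : ℕ} {v : Fin (n + 1) → Fin (n + 1)} (hv : IsPlanar d v)
    (hl : v (Fin.last n) ≠ Fin.last n) :
    ∃ p, dropLast v p = p ∧ (∀ i, dropLast v i = i → i ≤ p) ∧ v = TL.snocArc p (dropLast v) := by
  obtain ⟨p, hp⟩ := Fin.exists_castSucc_eq.2 hl
  have hvp : v p.castSucc = Fin.last n := by rw [hp, hv.1]
  refine ⟨p, dropLast_of_eq hvp, fun i hi => ?_, ?_⟩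
  · by_contra hlt
    rw [not_le] at hlt
    have h2 : v i.castSucc ≠ Fin.last n := by
      intro h
      exact hlt.ne' (Fin.castSucc_injective _ (hv.injective (h.trans hvp.symm)))
    have := castSucc_dropLast h2
    rw [hi] at this
    exact hv.2.2.1 p.castSucc i.castSucc (Fin.castSucc_lt_castSucc_iff.2 hlt)
      (hvp ▸ Fin.castSucc_lt_last i) this.symm
  · funext i
    induction i using Fin.lastCases with
    | last => simp [hp]
    | cast i =>
      by_cases hi : i = p
      · simp [hi, hvp]
      · have h2 : v i.castSucc ≠ Fin.last n := by
          intro h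
          exact hi (Fin.castSucc_injective _ (hv.injective (h.trans hvp.symm)))
        simp [hi, castSucc_dropLast h2]

lemma oddClosings_snocDefect {n : ℕ} (v : Fin n → Fin n) :
    oddClosings (snocDefect v) = oddClosings v := by
  rw [oddClosings, oddClosings, Finset.card_filter, Finset.card_filter, Fin.sum_univ_castSucc]
  simp

lemma oddClosings_snocArc {n : ℕ} {v : Fin n → Fin n} {p : Fin n} (hp : v p = p) :
    oddClosings (snocArc p v) = oddClosings v + n % 2 := by
  rw [oddClosings, oddClosings, Finset.card_filter, Finset.card_filter, Fin.sum_univ_castSucc]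
  congr 1
  · refine Finset.sum_congr rfl fun i _ => ?_
    by_cases hi : i = p
    · subst hi
      simp [hp, (Fin.castSucc_lt_last i).not_gt]
    · simp [hi]
  · rcases Nat.mod_two_eq_zero_or_one n with h | h <;> simp [h, Fin.castSucc_lt_last]

lemma planarSum_filter_arc (Q : ℝ) (n d : ℕ) :
    ∑ v : Fin (n + 1) → Fin (n + 1) with IsPlanar d v ∧ v (Fin.last n) ≠ Fin.last n,
      Q ^ oddClosings v = Q ^ (n % 2) * planarSum Q n (d + 1) := by
  rw [planarSum, Finset.mul_sum]
  refine Finset.sum_bij (fun v _ => dropLast v) ?_ ?_ ?_ ?_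
  · intro v hv
    simp only [Finset.mem_filter, Finset.mem_univ, true_and] at hv ⊢
    exact hv.1.dropLast_of_arc hv.2
  · intro v hv w hw hvw
    simp only [Finset.mem_filter, Finset.mem_univ, true_and] at hv hw
    obtain ⟨p, h1, h2, h3⟩ := hv.1.exists_snocArc hv.2
    obtain ⟨p', h1', h2', h3'⟩ := hw.1.exists_snocArc hw.2
    have : p = p' := le_antisymm (h2' _ (hvw ▸ h1)) (h2 _ (hvw ▸ h1'))
    rw [h3, h3', this, hvw]
  · intro w hw
    simp only [Finset.mem_filter, Finset.mem_univ, true_and] at hw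
    have hne : (Finset.univ.filter fun i => w i = i).Nonempty := by
      rw [← Finset.card_pos, hw.2.2.2]; omega
    have hp := Finset.max'_mem _ hne
    set p := Finset.max' _ hne
    simp only [Finset.mem_filter, Finset.mem_univ, true_and] at hp
    refine ⟨snocArc p w, ?_, dropLast_snocArc hp⟩
    simp only [Finset.mem_filter, Finset.mem_univ, true_and, snocArc_last]
    exact ⟨hw.snocArc hp fun i hi => Finset.le_max' _ _ (by simp [hi]),
      (Fin.castSucc_lt_last p).ne⟩
  · intro v hv
    simp only [Finset.mem_filter, Finset.mem_univ, true_and] at hv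
    obtain ⟨p, h1, h2, h3⟩ := hv.1.exists_snocArc hv.2
    conv_lhs => rw [h3, oddClosings_snocArc h1, pow_add, mul_comm]

lemma planarSum_filter_defect (Q : ℝ) (n d : ℕ) :
    ∑ v : Fin (n + 1) → Fin (n + 1) with IsPlanar (d + 1) v ∧ v (Fin.last n) = Fin.last n,
      Q ^ oddClosings v = planarSum Q n d := by
  rw [planarSum]
  refine Finset.sum_bij' (fun v _ => dropLast v) (fun v _ => snocDefect v) ?_ ?_ ?_ ?_ ?_
  · intro v hv
    simp only [Finset.mem_filter, Finset.mem_univ, true_and] at hv ⊢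
    exact hv.1.dropLast_of_defect hv.2
  · intro v hv
    simp only [Finset.mem_filter, Finset.mem_univ, true_and] at hv ⊢
    exact ⟨hv.snocDefect, by simp⟩
  · intro v hv
    simp only [Finset.mem_filter, Finset.mem_univ, true_and] at hv
    exact snocDefect_dropLast hv.1 hv.2
  · intro v hv
    exact dropLast_snocDefect v
  · intro v hv
    simp only [Finset.mem_filter, Finset.mem_univ, true_and] at hv
    conv_lhs => rw [← snocDefect_dropLast hv.1 hv.2, oddClosings_snocDefect]

lemma planarSum_succ_succ (Q : ℝ) (n d : ℕ) :
    planarSum Q (n + 1) (d + 1) = planarSum Q n d + Q ^ (n % 2) * planarSum Q n (d + 2) := by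
  rw [← planarSum_filter_arc, ← planarSum_filter_defect Q n d, ← Finset.filter_filter,
    ← Finset.filter_filter, Finset.sum_filter_add_sum_filter_not]
  rfl

lemma planarSum_succ_zero (Q : ℝ) (n : ℕ) :
    planarSum Q (n + 1) 0 = Q ^ (n % 2) * planarSum Q n 1 := by
  rw [← planarSum_filter_arc, planarSum]
  refine Finset.sum_congr (Finset.filter_congr fun v _ => ⟨fun h => ⟨h, fun h' => ?_⟩, And.left⟩)
    fun _ _ => rfl
  have := h.2.2.2
  rw [Finset.card_eq_zero, Finset.filter_eq_empty_iff] at this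
  exact this (Finset.mem_univ _) h'

lemma planarSum_zero (Q : ℝ) (d : ℕ) : planarSum Q 0 d = if d = 0 then 1 else 0 := by
  by_cases h : d = 0
  · subst h
    rw [if_pos rfl, planarSum, Finset.filter_true_of_mem]
    · simp [oddClosings]
    · intro v _
      exact ⟨fun i => i.elim0, fun i => i.elim0, fun i => i.elim0, by simp⟩
  · rw [if_neg h, planarSum, Finset.filter_false_of_mem, Finset.sum_empty]
    intro v _ hv
    exact h (by simpa using hv.2.2.2.symm)

/-- `G` counts link states by their number of shaded regions: both sides obey the recursion that
comes from adding two points at the end. -/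
lemma planarSum_eq_g {Q : ℝ} (hQ : Q ≠ 0) (μ k : ℕ) : planarSum Q (2 * μ) (2 * k) = g μ k Q := by
  induction μ generalizing k with
  | zero => simp [planarSum_zero, g_zero]
  | succ μ ih =>
    rw [show 2 * (μ + 1) = 2 * μ + 1 + 1 by ring]
    have h0 : (2 * μ) % 2 = 0 := by omega
    have h1 : (2 * μ + 1) % 2 = 1 := by omega
    rcases k with _ | k
    · rw [planarSum_succ_zero, planarSum_succ_succ, h0, h1, g_succ_zero μ hQ, ← ih 0, ← ih 1]
      ring
    · rw [show 2 * (k + 1) = (2 * k + 1) + 1 by ring, planarSum_succ_succ, planarSum_succ_succ,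
        show 2 * k + 1 + 2 = (2 * k + 2) + 1 by ring, planarSum_succ_succ, h0, h1, g_succ_succ,
        ← ih k, ← ih (k + 1), ← ih (k + 2)]
      ring_nf

lemma sum_linkState_eq_g {Q : ℝ} (hQ : Q ≠ 0) (μ k : ℕ) :
    ∑ v : LinkState (2 * μ) k, Q ^ oddClosings v.1 = g μ k Q := by
  rw [← planarSum_eq_g hQ, planarSum]
  exact (Finset.sum_subtype _ (by simp) (fun v => Q ^ oddClosings v)).symm

lemma planarSum_pos {Q : ℝ} (hQ : 0 < Q) {n d : ℕ} (h : d ≤ n) (h' : d % 2 = n % 2) :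
    0 < planarSum Q n d := by
  have nonneg (n d : ℕ) : 0 ≤ planarSum Q n d := Finset.sum_nonneg fun _ _ => by positivity
  induction n generalizing d with
  | zero => simp [planarSum_zero, Nat.le_zero.1 h]
  | succ n ih =>
    rcases d with _ | d
    · rw [planarSum_succ_zero]
      exact mul_pos (by positivity) (ih (by omega) (by omega))
    · rw [planarSum_succ_succ]
      have h1 := ih (d := d) (by omega) (by omega)
      have h2 : 0 ≤ Q ^ (n % 2) * planarSum Q n (d + 2) :=
        mul_nonneg (by positivity) (nonneg _ _)
      linarith

lemma g_pos {Q : ℝ} (hQ : 0 < Q) {μ k : ℕ} (h : k ≤ μ) : 0 < g μ k Q := by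
  rw [← planarSum_eq_g hQ.ne']
  exact planarSum_pos hQ (by omega) (by omega)

lemma exists_isPlanar {μ k : ℕ} (h : k ≤ μ) :
    ∃ x : Fin (2 * μ) → Fin (2 * μ), IsPlanar (2 * k) x := by
  by_contra hcon
  push Not at hcon
  have := planarSum_pos one_pos (show 2 * k ≤ 2 * μ by omega) (by omega)
  rw [planarSum, Finset.filter_false_of_mem fun v _ => hcon v, Finset.sum_empty] at this
  exact lt_irrefl _ this

lemma IsPlanar.card_not_defect {n d : ℕ} {x : Fin n → Fin n} (hx : IsPlanar d x) :
    (Finset.univ.filter fun i => x i ≠ i).card = n - d := by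
  have := Finset.card_filter_add_card_filter_not (s := (Finset.univ : Finset (Fin n)))
    (fun i => x i = i)
  rw [hx.2.2.2, Finset.card_univ, Fintype.card_fin] at this
  simp only [ne_eq]
  omega

/-! ### Perturbations of rank one matrices -/

/-- If the coefficients of monic real polynomials tend to those of `X ^ n * (X - Λ)`, then a real
root tends to `Λ` and the other complex roots stay away from it. -/
lemma exists_root_tendsto {α : Type*} {l : Filter α} (n : ℕ) (p : α → Polynomial ℝ) (Λ : ℝ)
    (hΛ : Λ ≠ 0)
    (hm : ∀ a, (p a).Monic) (hdeg : ∀ a, (p a).natDegree = n + 1)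
    (hlim : ∀ i, Tendsto (fun a => (p a).coeff i) l
      (𝓝 ((Polynomial.X ^ n * (Polynomial.X - Polynomial.C Λ)).coeff i))) :
    ∃ lam : α → ℝ, Tendsto lam l (𝓝 Λ) ∧ ∀ᶠ a in l, ∃ q : Polynomial ℝ,
      p a = (Polynomial.X - Polynomial.C (lam a)) * q ∧
      ∀ z : ℂ, (q.map (algebraMap ℝ ℂ)).IsRoot z → ‖z‖ ≤ |Λ| / 2 := by
  set P : Polynomial ℝ := Polynomial.X ^ n * (Polynomial.X - Polynomial.C Λ) with hP
  have hPdeg : P.natDegree = n + 1 := by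
    rw [hP, Polynomial.Monic.natDegree_mul (Polynomial.monic_X_pow n) (Polynomial.monic_X_sub_C Λ)]
    simp
  have hPeval (x : ℝ) : P.eval x = x ^ n * (x - Λ) := by simp [hP]
  set η := |Λ| / 2 with hη
  have hη0 : 0 < η := by positivity
  have heval (x : ℝ) : Tendsto (fun a => (p a).eval x) l (𝓝 (P.eval x)) := by
    have h1 : ∀ a, (p a).eval x = ∑ i ∈ Finset.range (n + 2), (p a).coeff i * x ^ i := fun a =>
      Polynomial.eval_eq_sum_range' (by rw [hdeg]; omega) x
    simp_rw [h1]
    rw [Polynomial.eval_eq_sum_range' (n := n + 2) (by rw [hPdeg]; omega) x]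
    exact tendsto_finsetSum _ fun i _ => (hlim i).mul_const _
  -- the limit polynomial changes sign between `Λ - η` and `Λ + η`, as `0` lies outside
  have hsign : P.eval (Λ - η) * P.eval (Λ + η) < 0 := by
    rw [hPeval, hPeval]
    have h2 : 0 < (Λ - η) * (Λ + η) := by
      have : Λ ^ 2 = |Λ| ^ 2 := (sq_abs Λ).symm
      have h3 : 0 < |Λ| := abs_pos.2 hΛ
      rw [hη]; nlinarith
    have h4 : (Λ - η) ^ n * (Λ - η - Λ) * ((Λ + η) ^ n * (Λ + η - Λ)) =
        - (((Λ - η) * (Λ + η)) ^ n * η ^ 2) := by rw [mul_pow]; ring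
    rw [h4]
    have := pow_pos h2 n
    have : 0 < ((Λ - η) * (Λ + η)) ^ n * η ^ 2 := by positivity
    linarith
  have hroot : ∀ᶠ a in l, ∃ x, |x - Λ| ≤ η ∧ (p a).eval x = 0 := by
    filter_upwards [((heval (Λ - η)).mul (heval (Λ + η))).eventually (gt_mem_nhds hsign)] with a ha
    have h0 : (0 : ℝ) ∈ Set.uIcc ((p a).eval (Λ - η)) ((p a).eval (Λ + η)) := by
      rw [Set.mem_uIcc]
      rcases mul_neg_iff.1 ha with h | h
      · exact Or.inr ⟨h.2.le, h.1.le⟩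
      · exact Or.inl ⟨h.1.le, h.2.le⟩
    obtain ⟨x, hx, hx0⟩ := intermediate_value_uIcc ((p a).continuous.continuousOn) h0
    refine ⟨x, ?_, hx0⟩
    rw [Set.uIcc_of_le (by linarith), Set.mem_Icc] at hx
    rw [abs_le]; constructor <;> linarith [hx.1, hx.2]
  have hchoose : ∃ lam : α → ℝ, ∀ᶠ a in l, |lam a - Λ| ≤ η ∧ (p a).eval (lam a) = 0 := by
    classical
    refine ⟨fun a => if h : ∃ x, |x - Λ| ≤ η ∧ (p a).eval x = 0 then h.choose else 0, ?_⟩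
    filter_upwards [hroot] with a ha
    simp only [dif_pos ha]
    exact ha.choose_spec
  obtain ⟨lam, hlam⟩ := hchoose
  -- at the root, `P` is small, and `lam a` is bounded away from the root `0` of `P`
  have hlim' : Tendsto lam l (𝓝 Λ) := by
    have hb : Tendsto (fun a => (∑ i ∈ Finset.range (n + 2),
        |P.coeff i - (p a).coeff i| * (2 * |Λ|) ^ i) / η ^ n) l (𝓝 0) := by
      have : (0 : ℝ) = (∑ i ∈ Finset.range (n + 2),
        |P.coeff i - P.coeff i| * (2 * |Λ|) ^ i) / η ^ n := by simp
      rw [this]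
      refine Tendsto.div_const (tendsto_finsetSum _ fun i _ => Tendsto.mul_const _ ?_) _
      exact (tendsto_const_nhds.sub (hlim i)).abs
    rw [tendsto_iff_dist_tendsto_zero]
    refine squeeze_zero' (Eventually.of_forall fun _ => dist_nonneg) ?_ hb
    filter_upwards [hlam] with a ⟨h1, h2⟩
    rw [Real.dist_eq, le_div_iff₀ (by positivity)]
    have h3 : η ≤ |lam a| := by
      have := abs_sub_abs_le_abs_sub Λ (lam a)
      rw [abs_sub_comm] at this
      linarith
    have h4 : |lam a| ≤ 2 * |Λ| := by
      have := abs_sub_abs_le_abs_sub (lam a) Λ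
      linarith
    have h5 : lam a ^ n * (lam a - Λ) =
        ∑ i ∈ Finset.range (n + 2), (P.coeff i - (p a).coeff i) * lam a ^ i := by
      rw [← hPeval, ← sub_zero (P.eval _), ← h2,
        Polynomial.eval_eq_sum_range' (n := n + 2) (by rw [hPdeg]; omega) _,
        Polynomial.eval_eq_sum_range' (n := n + 2) (by rw [hdeg]; omega) _,
        ← Finset.sum_sub_distrib]
      simp_rw [sub_mul]
    calc |lam a - Λ| * η ^ n ≤ |lam a - Λ| * |lam a| ^ n := by gcongr
      _ = |lam a ^ n * (lam a - Λ)| := by rw [abs_mul, abs_pow, mul_comm]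
      _ ≤ ∑ i ∈ Finset.range (n + 2), |(P.coeff i - (p a).coeff i) * lam a ^ i| := by
        rw [h5]; exact Finset.abs_sum_le_sum_abs _ _
      _ ≤ _ := by
        refine Finset.sum_le_sum fun i _ => ?_
        rw [abs_mul, abs_pow]
        gcongr
  refine ⟨lam, hlim', ?_⟩
  set q : α → Polynomial ℝ := fun a => p a /ₘ (Polynomial.X - Polynomial.C (lam a)) with hq
  have hpq : ∀ᶠ a in l, p a = (Polynomial.X - Polynomial.C (lam a)) * q a := by
    filter_upwards [hlam] with a ha
    exact (Polynomial.mul_divByMonic_eq_iff_isRoot.2 ha.2).symm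
  -- the low coefficients of the cofactor vanish in the limit, by recursion from the bottom
  have hqlim : ∀ i < n, Tendsto (fun a => (q a).coeff i) l (𝓝 0) := by
    intro i hi
    have hPi : P.coeff i = 0 := by
      rw [hP, Polynomial.coeff_X_pow_mul', if_neg (by omega)]
    have hpi := hlim i
    rw [hPi] at hpi
    have hdiv {f : α → ℝ} (hf : Tendsto f l (𝓝 0)) :
        Tendsto (fun a => f a / lam a) l (𝓝 0) := by
      have := hf.div hlim' hΛ
      rwa [zero_div] at this
    have hne : ∀ᶠ a in l, lam a ≠ 0 := hlim'.eventually_ne hΛ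
    induction i with
    | zero =>
      refine (hdiv (neg_zero (G := ℝ) ▸ hpi.neg)).congr' ?_
      filter_upwards [hpq, hne] with a ha hn
      rw [div_eq_iff hn, ha]
      simp [Polynomial.mul_coeff_zero]
      ring
    | succ i ih =>
      have hPi' : P.coeff i = 0 := by
        rw [hP, Polynomial.coeff_X_pow_mul', if_neg (by omega)]
      have ih' := ih (by omega) hPi' (hPi' ▸ hlim i)
      have := ih'.sub hpi
      rw [sub_zero] at this
      refine (hdiv this).congr' ?_
      filter_upwards [hpq, hne] with a ha hn
      rw [div_eq_iff hn]
      have e : (p a).coeff (i + 1) = (q a).coeff i - lam a * (q a).coeff (i + 1) := by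
        conv_lhs => rw [ha]
        rw [sub_mul, Polynomial.coeff_sub, Polynomial.coeff_X_mul, Polynomial.coeff_C_mul]
      rw [e]; ring
  -- so a root `z` of the cofactor with `‖z‖ > η` would contradict `z ^ n = -∑ i < n, qᵢ z ^ i`
  have hsmall : ∀ᶠ a in l, ∑ i ∈ Finset.range n, |(q a).coeff i| / η ^ (n - i) < 1 := by
    have : Tendsto (fun a => ∑ i ∈ Finset.range n, |(q a).coeff i| / η ^ (n - i)) l
        (𝓝 (∑ i ∈ Finset.range n, |0| / η ^ (n - i))) :=
      tendsto_finsetSum _ fun i hi => ((hqlim i (Finset.mem_range.1 hi)).abs).div_const _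
    simp only [abs_zero, zero_div, Finset.sum_const_zero] at this
    exact this.eventually (gt_mem_nhds one_pos)
  filter_upwards [hpq, hsmall] with a ha hs
  refine ⟨q a, ha, fun z hz => ?_⟩
  have hqm : (q a).Monic := (Polynomial.monic_X_sub_C (lam a)).of_mul_monic_left (ha ▸ hm a)
  have hqd : (q a).natDegree = n := by
    have := hdeg a
    rw [ha, Polynomial.Monic.natDegree_mul (Polynomial.monic_X_sub_C _) hqm,
      Polynomial.natDegree_X_sub_C] at this
    omega
  by_contra hlt
  rw [not_le] at hlt
  have hz0 : 0 < ‖z‖ := hη0.trans hlt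
  have h1 : z ^ n = - ∑ i ∈ Finset.range n, ((q a).coeff i : ℂ) * z ^ i := by
    have h2 : (Polynomial.map (algebraMap ℝ ℂ) (q a)).eval z = 0 := hz
    rw [Polynomial.eval_eq_sum_range' (n := n + 1) (by rw [Polynomial.natDegree_map]; omega),
      Finset.sum_range_succ, Polynomial.coeff_map, ← hqd, hqm.coeff_natDegree, hqd] at h2
    simp only [Polynomial.coeff_map, map_one, one_mul, Complex.coe_algebraMap] at h2
    exact eq_neg_of_add_eq_zero_right h2
  have h3 : ‖z‖ ^ n ≤ ∑ i ∈ Finset.range n, |(q a).coeff i| * ‖z‖ ^ i := by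
    rw [← norm_pow, h1, norm_neg]
    refine (norm_sum_le _ _).trans (Finset.sum_le_sum fun i _ => ?_)
    rw [norm_mul, norm_pow, Complex.norm_real, Real.norm_eq_abs]
  have h4 : ∑ i ∈ Finset.range n, |(q a).coeff i| * ‖z‖ ^ i ≤
      (∑ i ∈ Finset.range n, |(q a).coeff i| / η ^ (n - i)) * ‖z‖ ^ n := by
    rw [Finset.sum_mul]
    refine Finset.sum_le_sum fun i hi => ?_
    have hi' := Finset.mem_range.1 hi
    rw [div_mul_eq_mul_div, le_div_iff₀ (by positivity), mul_assoc]
    refine mul_le_mul_of_nonneg_left ?_ (abs_nonneg _)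
    calc ‖z‖ ^ i * η ^ (n - i) ≤ ‖z‖ ^ i * ‖z‖ ^ (n - i) := by gcongr
      _ = ‖z‖ ^ n := by rw [← pow_add]; congr 1; omega
  have h5 : 0 < ‖z‖ ^ n := by positivity
  nlinarith

/-- The scalar estimate behind the second order suppression. Here `s` and `t` are the components of
an eigenvector along the two rank one factors; both turn out to be of order `ε`, and feeding this
back into the eigenvalue equation leaves only terms of order `ε ^ 2`. -/
lemma norm_le_of_eigen_equations {Λ K : ℝ} {W U : ℂ} (hW : W ≠ 0) (hΛ : Λ ≠ 0)
    (hWU : (Λ : ℂ) = U * W) (hK : 1 ≤ K) (hWK : ‖W‖ ≤ K) :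
    ∃ C ε₀ : ℝ, 0 < ε₀ ∧ ∀ ε : ℝ, 0 < ε → ε ≤ ε₀ → ∀ z s t α β γ u a c v : ℂ,
      ‖α‖ ≤ K → ‖β‖ ≤ K → ‖γ‖ ≤ K → ‖u‖ ≤ K → ‖a‖ ≤ K → ‖c‖ ≤ K → ‖v‖ = 1 → ‖z‖ ≤ |Λ| / 2 →
      t = U * s + ε * β → z * s = W * t + ε * s * α + ε ^ 2 * γ →
      z * v = u * t + ε * s * a + ε ^ 2 * c → ‖z‖ ≤ C * ε ^ 2 := by
  set L := |Λ| with hL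
  have hL0 : 0 < L := abs_pos.2 hΛ
  have hW0 : 0 < ‖W‖ := norm_pos_iff.2 hW
  set S := 4 / L * (K * K + K) with hS
  have hS0 : 0 < S := by positivity
  set T := S * K + K with hT
  have hT0 : 0 < T := by positivity
  refine ⟨2 * (K / ‖W‖ * T + T), min 1 (min (L / (4 * K)) (‖W‖ / (2 * K * S))), by positivity, ?_⟩
  intro ε hε hε' z s t α β γ u a c v hα hβ hγ hu ha hc hv hz ht hzs hzv
  have h1 : ε ≤ 1 := hε'.trans (min_le_left _ _)
  have h2 : ε ≤ L / (4 * K) := hε'.trans ((min_le_right _ _).trans (min_le_left _ _))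
  have h3 : ε ≤ ‖W‖ / (2 * K * S) := hε'.trans ((min_le_right _ _).trans (min_le_right _ _))
  rw [le_div_iff₀ (by positivity)] at h2 h3
  have nε : ‖(ε : ℂ)‖ = ε := by rw [Complex.norm_real, Real.norm_of_nonneg hε.le]
  have nε2 : ‖(ε : ℂ) ^ 2‖ = ε ^ 2 := by rw [norm_pow, nε]
  -- eliminating `t` leaves `(Λ + ε α - z) s = O(ε)`, and `z` is far from `Λ`
  have hs : ‖s‖ ≤ S * ε := by
    have e : (Λ + ε * α - z) * s = - (ε * (W * β) + ε ^ 2 * γ) := by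
      rw [hWU]; linear_combination -hzs - W * ht
    have e1 : L / 4 ≤ ‖(Λ + ε * α - z : ℂ)‖ := by
      have i1 : ‖(Λ : ℂ)‖ = L := by rw [Complex.norm_real, Real.norm_eq_abs]
      have i2 : ‖(ε * α : ℂ)‖ ≤ ε * K := by rw [norm_mul, nε]; gcongr
      have i3 : ‖(Λ : ℂ)‖ ≤ ‖(Λ + ε * α - z : ℂ)‖ + ‖(ε * α : ℂ)‖ + ‖z‖ := by
        calc ‖(Λ : ℂ)‖ = ‖(Λ + ε * α - z : ℂ) - ε * α + z‖ := by ring_nf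
          _ ≤ _ := (norm_add_le _ _).trans (by gcongr; exact norm_sub_le _ _)
      nlinarith
    have e2 : ‖(Λ + ε * α - z : ℂ)‖ * ‖s‖ ≤ (K * K + K) * ε := by
      rw [← norm_mul, e, norm_neg]
      calc _ ≤ ‖(ε * (W * β) : ℂ)‖ + ‖(ε ^ 2 * γ : ℂ)‖ := norm_add_le _ _
        _ ≤ ε * (K * K) + ε ^ 2 * K := by
          rw [norm_mul, norm_mul, norm_mul, nε, nε2]; gcongr
        _ ≤ ε * (K * K) + ε * K := by gcongr; nlinarith
        _ = _ := by ring
    have e3 : L / 4 * ‖s‖ ≤ (K * K + K) * ε :=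
      (mul_le_mul_of_nonneg_right e1 (norm_nonneg _)).trans e2
    rw [hS]
    have : 4 / L * (K * K + K) * ε = (K * K + K) * ε / (L / 4) := by field_simp
    rw [this, le_div_iff₀ (by positivity)]
    linarith
  have hrest (a c : ℂ) (ha : ‖a‖ ≤ K) (hc : ‖c‖ ≤ K) :
      ‖(ε * s * a + ε ^ 2 * c : ℂ)‖ ≤ T * ε ^ 2 := by
    calc _ ≤ ‖(ε * s * a : ℂ)‖ + ‖(ε ^ 2 * c : ℂ)‖ := norm_add_le _ _
      _ ≤ ε * (S * ε) * K + ε ^ 2 * K := by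
        rw [norm_mul, norm_mul, norm_mul, nε, nε2]; gcongr
      _ = _ := by rw [hT]; ring
  -- the equation for `z * s` now bounds `t` by `‖z‖ ε` up to order `ε ^ 2`
  have htb : ‖t‖ ≤ (‖z‖ * (S * ε) + T * ε ^ 2) / ‖W‖ := by
    rw [le_div_iff₀ hW0, ← norm_mul]
    have : t * W = z * s - (ε * s * α + ε ^ 2 * γ) := by rw [hzs]; ring
    rw [this]
    refine (norm_sub_le _ _).trans (add_le_add ?_ (hrest α γ hα hγ))
    rw [norm_mul]; gcongr
  have hfin : ‖z‖ ≤ K * ((‖z‖ * (S * ε) + T * ε ^ 2) / ‖W‖) + T * ε ^ 2 := by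
    calc ‖z‖ = ‖z * v‖ := by rw [norm_mul, hv, mul_one]
      _ = ‖u * t + (ε * s * a + ε ^ 2 * c)‖ := by rw [hzv]; ring_nf
      _ ≤ ‖u * t‖ + ‖(ε * s * a + ε ^ 2 * c : ℂ)‖ := norm_add_le _ _
      _ ≤ _ := by rw [norm_mul]; gcongr; exact hrest a c ha hc
  have h6 : K * ((‖z‖ * (S * ε) + T * ε ^ 2) / ‖W‖) =
      ‖z‖ * (ε * K * S / ‖W‖) + K / ‖W‖ * T * ε ^ 2 := by field_simp
  have h7 : ε * K * S / ‖W‖ ≤ 1 / 2 := by rw [div_le_iff₀ hW0]; linarith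
  have h8 := mul_le_mul_of_nonneg_left h7 (norm_nonneg z)
  rw [h6] at hfin
  linarith

open Matrix in
/-- A product of two perturbations of rank one matrices has, up to second order, no eigenvalues
besides the one that perturbs the eigenvalue of the product of the rank one matrices. -/
lemma exists_eigenvalue_bound {ι : Type*} [Fintype ι] [DecidableEq ι] (u u' w' w : ι → ℝ)
    (Λ : ℝ) (hΛ : Λ = (u' ⬝ᵥ w') * (w ⬝ᵥ u)) (hΛ0 : Λ ≠ 0) (k₀ : ℝ) :
    ∃ C ε₀ : ℝ, 0 < ε₀ ∧ ∀ ε : ℝ, 0 < ε → ε ≤ ε₀ → ∀ A B : Matrix ι ι ℝ,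
      (∀ i j, |A i j| ≤ k₀) → (∀ i j, |B i j| ≤ k₀) →
      ∀ z : ℂ, ((((vecMulVec u u' + ε • A) * (vecMulVec w' w + ε • B)).charpoly).map
        (algebraMap ℝ ℂ)).IsRoot z → ‖z‖ ≤ |Λ| / 2 → ‖z‖ ≤ C * ε ^ 2 := by
  have hwu : w ⬝ᵥ u ≠ 0 := fun h => hΛ0 (by rw [hΛ, h, mul_zero])
  let c (x : ι → ℝ) : ι → ℂ := fun i => (x i : ℂ)
  set k := |k₀| with hk
  set nn : ℝ := (Fintype.card ι : ℝ)
  let l1 (x : ι → ℝ) : ℝ := ∑ i, |x i|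
  have hl1 (x : ι → ℝ) : 0 ≤ l1 x := Finset.sum_nonneg fun i _ => abs_nonneg _
  have hnn : 0 ≤ nn := Nat.cast_nonneg _
  have hk0 : 0 ≤ k := abs_nonneg _
  have hdot (x : ι → ℝ) (y : ι → ℂ) (b : ℝ) (hy : ∀ i, ‖y i‖ ≤ b) : ‖c x ⬝ᵥ y‖ ≤ l1 x * b := by
    rw [dotProduct, Finset.sum_mul]
    refine (norm_sum_le _ _).trans (Finset.sum_le_sum fun i _ => ?_)
    rw [norm_mul, Complex.norm_real, Real.norm_eq_abs]
    exact mul_le_mul_of_nonneg_left (hy i) (abs_nonneg _)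
  have hmul (A : Matrix ι ι ℝ) (hA : ∀ i j, |A i j| ≤ k₀) (y : ι → ℂ) (b : ℝ) (hb : 0 ≤ b)
      (hy : ∀ i, ‖y i‖ ≤ b) (i : ι) : ‖(A.map (algebraMap ℝ ℂ) *ᵥ y) i‖ ≤ nn * (k * b) := by
    have : nn * (k * b) = ∑ _i : ι, k * b := by simp [nn]
    rw [this, mulVec, dotProduct]
    refine (norm_sum_le _ _).trans (Finset.sum_le_sum fun j _ => ?_)
    rw [norm_mul, map_apply, Complex.coe_algebraMap, Complex.norm_real, Real.norm_eq_abs]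
    exact mul_le_mul ((hA i j).trans (le_abs_self _)) (hy j) (norm_nonneg _) hk0
  have hle (x : ι → ℝ) (i : ι) : ‖c x i‖ ≤ l1 x := by
    simp only [c, Complex.norm_real, Real.norm_eq_abs]
    exact Finset.single_le_sum (f := fun i => |x i|) (fun i _ => abs_nonneg _) (Finset.mem_univ i)
  set K : ℝ := 1 + |w ⬝ᵥ u| + l1 w * (nn * (k * l1 w')) + l1 u' * (nn * (k * 1)) +
    l1 w * (nn * (k * (nn * (k * 1)))) + l1 u + nn * (k * l1 w') +
    nn * (k * (nn * (k * 1))) with hKdef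
  have b1 : 0 ≤ |w ⬝ᵥ u| := abs_nonneg _
  have b2 : 0 ≤ l1 w * (nn * (k * l1 w')) := by have := hl1 w; have := hl1 w'; positivity
  have b3 : 0 ≤ l1 u' * (nn * (k * 1)) := by have := hl1 u'; positivity
  have b4 : 0 ≤ l1 w * (nn * (k * (nn * (k * 1)))) := by have := hl1 w; positivity
  have b5 := hl1 u
  have b6 : 0 ≤ nn * (k * l1 w') := by have := hl1 w'; positivity
  have b7 : 0 ≤ nn * (k * (nn * (k * 1))) := by positivity
  have hcdot (x y : ι → ℝ) : c x ⬝ᵥ c y = ((x ⬝ᵥ y : ℝ) : ℂ) := by simp [c, dotProduct]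
  obtain ⟨C, ε₀, hε₀, H⟩ := norm_le_of_eigen_equations (Λ := Λ) (K := K)
    (W := ((w ⬝ᵥ u : ℝ) : ℂ)) (U := ((u' ⬝ᵥ w' : ℝ) : ℂ)) (by exact_mod_cast hwu) hΛ0
    (by exact_mod_cast hΛ) (by linarith)
    (by rw [Complex.norm_real, Real.norm_eq_abs]; linarith)
  refine ⟨C, ε₀, hε₀, fun ε hε hε' A B hA hB z hz hzs => ?_⟩
  rw [← charpoly_map, Polynomial.IsRoot, eval_charpoly, ← exists_mulVec_eq_zero_iff] at hz
  obtain ⟨v, hv0, hv⟩ := hz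
  have hne : Nonempty ι := by
    by_contra h
    rw [not_nonempty_iff] at h
    exact hv0 (Subsingleton.elim _ _)
  -- normalise the eigenvector at a coordinate of maximal absolute value
  obtain ⟨i₀, hi₀⟩ := Finite.exists_max fun i => ‖v i‖
  have hvi : v i₀ ≠ 0 := by
    intro h
    refine hv0 (funext fun i => ?_)
    have := hi₀ i
    rw [h, norm_zero] at this
    exact norm_le_zero_iff.1 this
  set y : ι → ℂ := (v i₀)⁻¹ • v with hy
  have hy1 : ∀ i, ‖y i‖ ≤ 1 := by
    intro i
    simp only [hy, Pi.smul_apply, smul_eq_mul, norm_mul, norm_inv]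
    rw [inv_mul_le_iff₀ (norm_pos_iff.2 hvi), mul_one]
    exact hi₀ i
  have hyi : ‖y i₀‖ = 1 := by simp [hy, hvi]
  set A' := A.map (algebraMap ℝ ℂ)
  set B' := B.map (algebraMap ℝ ℂ)
  have hmapvec (a b : ι → ℝ) (D : Matrix ι ι ℝ) (x : ι → ℂ) :
      ((vecMulVec a b + ε • D).map (algebraMap ℝ ℂ)) *ᵥ x =
        (c b ⬝ᵥ x) • c a + (ε : ℂ) • (D.map (algebraMap ℝ ℂ) *ᵥ x) := by
    ext i
    simp only [mulVec, dotProduct, map_apply, Matrix.add_apply, vecMulVec_apply,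
      Matrix.smul_apply, c,
      Pi.add_apply, Pi.smul_apply, smul_eq_mul, Complex.coe_algebraMap, Complex.ofReal_add,
      Complex.ofReal_mul]
    rw [Finset.mul_sum, Finset.sum_mul, ← Finset.sum_add_distrib]
    exact Finset.sum_congr rfl fun j _ => by ring
  have heig : (z : ℂ) • y = (c u' ⬝ᵥ ((c w ⬝ᵥ y) • c w' + (ε : ℂ) • (B' *ᵥ y))) • c u +
      (ε : ℂ) • (A' *ᵥ ((c w ⬝ᵥ y) • c w' + (ε : ℂ) • (B' *ᵥ y))) := by
    rw [← hmapvec w' w B y, ← hmapvec u u' A, mulVec_mulVec, ← Matrix.map_mul, hy, mulVec_smul,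
      smul_comm]
    congr 1
    rw [sub_mulVec, sub_eq_zero] at hv
    rw [← hv]
    ext i
    simp [scalar_apply, mulVec_diagonal]
  set s := c w ⬝ᵥ y with hs
  set t := c u' ⬝ᵥ (s • c w' + (ε : ℂ) • (B' *ᵥ y)) with ht
  have heig' : z • y = t • c u + (ε * s) • (A' *ᵥ c w') + ((ε : ℂ) ^ 2) • (A' *ᵥ (B' *ᵥ y)) := by
    rw [heig, mulVec_add, mulVec_smul, mulVec_smul, smul_add, smul_smul, smul_smul, ← sq, add_assoc]
  have hB1 := hmul B hB y 1 zero_le_one hy1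
  have hAB := hmul A hA (B' *ᵥ y) _ (by positivity) hB1
  have hAw := hmul A hA (c w') _ (hl1 w') (hle w')
  refine H ε hε hε' z s t (c w ⬝ᵥ (A' *ᵥ c w')) (c u' ⬝ᵥ (B' *ᵥ y)) (c w ⬝ᵥ (A' *ᵥ (B' *ᵥ y)))
    (c u i₀) ((A' *ᵥ c w') i₀) ((A' *ᵥ (B' *ᵥ y)) i₀) (y i₀) ?_ ?_ ?_ ?_ ?_ ?_ hyi hzs ?_ ?_ ?_
  · exact (hdot w _ _ hAw).trans (by linarith)
  · exact (hdot u' _ _ hB1).trans (by linarith)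
  · exact (hdot w _ _ hAB).trans (by linarith)
  · exact (hle u i₀).trans (by linarith)
  · exact (hAw i₀).trans (by linarith)
  · exact (hAB i₀).trans (by linarith)
  · rw [ht, dotProduct_add, dotProduct_smul, dotProduct_smul, hcdot, smul_eq_mul, smul_eq_mul]
    ring
  · have := congrArg (fun x => c w ⬝ᵥ x) heig'
    simp only [dotProduct_add, dotProduct_smul, hcdot, smul_eq_mul] at this
    rw [← hs] at this
    rw [this]; ring
  · have := congrFun heig' i₀
    simp only [Pi.add_apply, Pi.smul_apply, smul_eq_mul] at this
    rw [this]; ring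

open Matrix in
lemma continuous_charpoly_coeff {ι : Type*} [Fintype ι] [DecidableEq ι] (i : ℕ) :
    Continuous fun M : Matrix ι ι ℝ => M.charpoly.coeff i := by
  have h (M : Matrix ι ι ℝ) : M.charpoly.coeff i =
      MvPolynomial.eval (fun x : ι × ι => M x.1 x.2) ((charpoly.univ ℝ ι).coeff i) := by
    have := charpoly.univ_coeff_eval₂Hom (R := ℝ) (n := ι) (f := RingHom.id ℝ)
      (fun x : ι × ι => M x.1 x.2) i
    exact this.symm
  simp_rw [h]
  exact (MvPolynomial.continuous_eval _).comp
    (continuous_pi fun x => continuous_id.matrix_elem x.1 x.2)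

open Matrix in
lemma charpoly_smul_eq {ι : Type*} [Fintype ι] [DecidableEq ι] {c : ℝ} (hc : c ≠ 0)
    (M : Matrix ι ι ℝ) : (c • M).charpoly = Polynomial.C (c ^ Fintype.card ι) *
      M.charpoly.comp (Polynomial.C c⁻¹ * Polynomial.X) := by
  refine Polynomial.funext fun x => ?_
  rw [eval_charpoly, Polynomial.eval_mul, Polynomial.eval_C, Polynomial.eval_comp, eval_charpoly,
    ← det_smul]
  congr 1
  ext i j
  simp [scalar_apply, diagonal_apply, mul_sub]
  split_ifs <;> field_simp

open Matrix in
lemma charpoly_vecMulVec_eq {ι : Type*} [Fintype ι] [DecidableEq ι] [Nonempty ι] (u v : ι → ℝ) :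
    (vecMulVec u v).charpoly = Polynomial.X ^ (Fintype.card ι - 1) *
      (Polynomial.X - Polynomial.C (u ⬝ᵥ v)) := by
  have : Fintype.card ι = Fintype.card ι - 1 + 1 := by have := Fintype.card_pos (α := ι); omega
  rw [charpoly_vecMulVec, mul_sub, Polynomial.smul_eq_C_mul, mul_comm (Polynomial.C _)]
  conv_lhs => rw [this, pow_succ]
  simp

open Matrix in
lemma rank_vecMulVec_eq_one {ι : Type*} [Fintype ι] {u v : ι → ℝ} (h : u ⬝ᵥ v ≠ 0) :
    (vecMulVec u v).rank = 1 := by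
  refine le_antisymm (rank_vecMulVec_le u v) (Nat.one_le_iff_ne_zero.2 fun h0 => h ?_)
  rw [Matrix.rank, Submodule.finrank_eq_zero, LinearMap.range_eq_bot] at h0
  have h1 : vecMulVec u v *ᵥ u = 0 := LinearMap.congr_fun h0 u
  have h2 : v ⬝ᵥ (vecMulVec u v *ᵥ u) = (u ⬝ᵥ v) * (u ⬝ᵥ v) := by
    simp only [dotProduct, mulVec, vecMulVec_apply, Finset.mul_sum, Finset.sum_mul]
    exact Finset.sum_congr rfl fun i _ => Finset.sum_congr rfl fun j _ => by ring
  rw [h1, dotProduct_zero] at h2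
  exact mul_self_eq_zero.1 h2.symm

open Matrix in
/-- Spectral asymptotics of `χ ^ d` times a product of two `χ⁻¹`-perturbations of rank one
matrices. -/
lemma spectrum_of_rank_one_perturbation {ι : Type*} [Fintype ι] [DecidableEq ι]
    (u u' w' w : ι → ℝ) (Λ : ℝ) (hΛ : Λ = (u' ⬝ᵥ w') * (w ⬝ᵥ u)) (hΛ0 : Λ ≠ 0) (d : ℕ) (k₀ : ℝ)
    (N A B : ℝ → Matrix ι ι ℝ)
    (hN : ∀ᶠ χ : ℝ in atTop, N χ = χ ^ d •
      ((vecMulVec u u' + χ⁻¹ • A χ) * (vecMulVec w' w + χ⁻¹ • B χ)))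
    (hA : ∀ᶠ χ : ℝ in atTop, ∀ i j, |A χ i j| ≤ k₀)
    (hB : ∀ᶠ χ : ℝ in atTop, ∀ i j, |B χ i j| ≤ k₀) :
    (∃ R : Matrix ι ι ℝ, Tendsto (fun χ : ℝ => (χ ^ d)⁻¹ • N χ) atTop (𝓝 R) ∧ R.rank = 1 ∧
      R.charpoly = Polynomial.X ^ (Fintype.card ι - 1) * (Polynomial.X - Polynomial.C Λ)) ∧
    ∃ (lam : ℝ → ℝ) (K : ℝ), Tendsto (fun χ : ℝ => lam χ / χ ^ d) atTop (𝓝 Λ) ∧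
      ∀ᶠ χ : ℝ in atTop,
        ((N χ).charpoly.map (algebraMap ℝ ℂ)).rootMultiplicity (lam χ : ℂ) = 1 ∧
        ∀ z : ℂ, ((N χ).charpoly.map (algebraMap ℝ ℂ)).IsRoot z → z ≠ (lam χ : ℂ) →
          ‖z‖ ≤ K * χ ^ d / χ ^ 2 := by
  have hwu : w ⬝ᵥ u ≠ 0 := fun h => hΛ0 (by rw [hΛ, h, mul_zero])
  have hne : Nonempty ι := by
    by_contra h
    rw [not_nonempty_iff] at h
    exact hwu (by simp)
  set P : ℝ → Matrix ι ι ℝ := fun χ =>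
    (vecMulVec u u' + χ⁻¹ • A χ) * (vecMulVec w' w + χ⁻¹ • B χ) with hP
  have hpert {D : ℝ → Matrix ι ι ℝ} (hD : ∀ᶠ χ : ℝ in atTop, ∀ i j, |D χ i j| ≤ k₀)
      (D₀ : Matrix ι ι ℝ) : Tendsto (fun χ => D₀ + χ⁻¹ • D χ) atTop (𝓝 D₀) := by
    have : Tendsto (fun χ : ℝ => χ⁻¹ • D χ) atTop (𝓝 0) := by
      refine tendsto_pi_nhds.2 fun i => tendsto_pi_nhds.2 fun j => ?_
      refine squeeze_zero_norm' (a := fun χ : ℝ => |χ⁻¹| * k₀) ?_ ?_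
      · filter_upwards [hD] with χ h
        rw [Matrix.smul_apply, norm_smul, Real.norm_eq_abs, Real.norm_eq_abs]
        exact mul_le_mul_of_nonneg_left (h i j) (abs_nonneg _)
      · have := (tendsto_inv_atTop_zero (𝕜 := ℝ)).abs.mul_const k₀
        simpa using this
    simpa using tendsto_const_nhds.add this
  set R := vecMulVec u u' * vecMulVec w' w with hR
  have hRe : R = vecMulVec ((u' ⬝ᵥ w') • u) w := by
    rw [hR, vecMulVec_mul_vecMulVec]
    ext i j
    simp only [vecMulVec_apply, Pi.smul_apply, smul_eq_mul]
    ring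
  have hRdot : ((u' ⬝ᵥ w') • u) ⬝ᵥ w = Λ := by
    rw [smul_dotProduct, hΛ, smul_eq_mul, dotProduct_comm u w]
  have hPR : Tendsto P atTop (𝓝 R) := (hpert hA _).mul (hpert hB _)
  have hRchar : R.charpoly =
      Polynomial.X ^ (Fintype.card ι - 1) * (Polynomial.X - Polynomial.C Λ) := by
    rw [hRe, charpoly_vecMulVec_eq, hRdot]
  have hNP : ∀ᶠ χ : ℝ in atTop, (χ ^ d)⁻¹ • N χ = P χ := by
    filter_upwards [hN, eventually_gt_atTop 0] with χ h h0
    rw [h, smul_smul, inv_mul_cancel₀ (by positivity), one_smul]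
  refine ⟨⟨R, hPR.congr' (hNP.mono fun χ h => h.symm), ?_, hRchar⟩, ?_⟩
  · rw [hRe]
    exact rank_vecMulVec_eq_one (hRdot ▸ hΛ0)
  have hcard : Fintype.card ι = Fintype.card ι - 1 + 1 := by
    have := Fintype.card_pos (α := ι); omega
  obtain ⟨lam, hlam, hq⟩ := exists_root_tendsto (l := atTop) (Fintype.card ι - 1)
    (fun χ => (P χ).charpoly) Λ hΛ0 (fun χ => charpoly_monic _)
    (fun χ => by rw [charpoly_natDegree_eq_dim, ← hcard]) (fun i => by
      rw [← hRchar]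
      exact ((continuous_charpoly_coeff i).tendsto R).comp hPR)
  obtain ⟨C, ε₀, hε₀, hC⟩ := exists_eigenvalue_bound u u' w' w Λ hΛ hΛ0 k₀
  refine ⟨fun χ => χ ^ d * lam χ, C, ?_, ?_⟩
  · refine hlam.congr' ?_
    filter_upwards [eventually_gt_atTop 0] with χ h0
    rw [mul_div_cancel_left₀]; positivity
  have hfar : ∀ᶠ χ in atTop, |Λ| / 2 < |lam χ| :=
    hlam.abs.eventually (lt_mem_nhds (half_lt_self (abs_pos.2 hΛ0)))
  filter_upwards [hN, hA, hB, hq, hfar, eventually_gt_atTop 0,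
    (tendsto_inv_atTop_zero (𝕜 := ℝ)).eventually (gt_mem_nhds hε₀)] with χ hN hA hB hq hfar h0 hε
  obtain ⟨q, hpq, hqroot⟩ := hq
  have hχ : χ ^ d ≠ 0 := by positivity
  have hχ' : ((χ : ℂ) ^ d) ≠ 0 := by exact_mod_cast hχ
  have hchar : (N χ).charpoly.map (algebraMap ℝ ℂ) =
      (Polynomial.X - Polynomial.C ((χ ^ d * lam χ : ℝ) : ℂ)) *
        (Polynomial.C ((χ : ℂ) ^ d) ^ (Fintype.card ι - 1) *
          (q.map (algebraMap ℝ ℂ)).comp (Polynomial.C ((χ : ℂ) ^ d)⁻¹ * Polynomial.X)) := by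
    rw [hN, charpoly_smul_eq hχ, hpq, hcard, Nat.add_sub_cancel]
    refine Polynomial.funext fun x => ?_
    simp only [Polynomial.map_mul, Polynomial.map_comp, Polynomial.map_sub, Polynomial.map_X,
      Polynomial.map_C, Polynomial.eval_mul, Polynomial.eval_comp, Polynomial.eval_sub,
      Polynomial.eval_X, Polynomial.eval_C, Polynomial.eval_pow, map_inv₀, map_pow,
      Complex.coe_algebraMap, Complex.ofReal_mul, Complex.ofReal_pow, pow_succ]
    field_simp
  set F := Polynomial.C ((χ : ℂ) ^ d) ^ (Fintype.card ι - 1) *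
          (q.map (algebraMap ℝ ℂ)).comp (Polynomial.C ((χ : ℂ) ^ d)⁻¹ * Polynomial.X) with hF
  have hFroot (z : ℂ) (hz : F.IsRoot z) :
      (q.map (algebraMap ℝ ℂ)).IsRoot (((χ : ℂ) ^ d)⁻¹ * z) := by
    rw [Polynomial.IsRoot, hF, Polynomial.eval_mul, Polynomial.eval_pow, Polynomial.eval_C,
      Polynomial.eval_comp] at hz
    have := (mul_eq_zero.1 hz).resolve_left (pow_ne_zero _ hχ')
    simpa using this
  have hnot : ¬ F.IsRoot ((χ ^ d * lam χ : ℝ) : ℂ) := by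
    intro h
    have := hqroot _ (hFroot _ h)
    rw [Complex.ofReal_mul, Complex.ofReal_pow, inv_mul_cancel_left₀ hχ', Complex.norm_real,
      Real.norm_eq_abs] at this
    linarith
  have hF0 : (Polynomial.X - Polynomial.C ((χ ^ d * lam χ : ℝ) : ℂ)) * F ≠ 0 := by
    refine mul_ne_zero (Polynomial.X_sub_C_ne_zero _) ?_
    rintro h
    exact hnot (by rw [h]; simp [Polynomial.IsRoot])
  rw [hchar]
  refine ⟨?_, fun z hz hzne => ?_⟩
  · rw [Polynomial.rootMultiplicity_mul hF0, Polynomial.rootMultiplicity_X_sub_C_self,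
      Polynomial.rootMultiplicity_eq_zero hnot]
  · have hz' : F.IsRoot z := by
      rw [Polynomial.IsRoot, Polynomial.eval_mul] at hz
      refine (mul_eq_zero.1 hz).resolve_left ?_
      simpa [sub_eq_zero] using hzne
    have h1 := hFroot z hz'
    have h2 : ‖((χ : ℂ) ^ d)⁻¹ * z‖ ≤ C * χ⁻¹ ^ 2 := by
      refine hC χ⁻¹ (by positivity) hε.le (A χ) (B χ) hA hB _ ?_ (hqroot _ h1)
      change ((P χ).charpoly.map _).IsRoot _
      rw [hpq, Polynomial.map_mul, Polynomial.IsRoot, Polynomial.eval_mul, h1, mul_zero]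
    rw [norm_mul, norm_inv, norm_pow, Complex.norm_real, Real.norm_of_nonneg h0.le,
      inv_mul_le_iff₀ (by positivity)] at h2
    calc ‖z‖ ≤ _ := h2
      _ = _ := by field_simp

/-! ### Gluing a diagram to a link state -/

lemma two_mul_ncard_le_card {α β : Type*} [Finite β] {f : α → β} {S : Finset α} {T : Set β}
    (h : ∀ t ∈ T, ∃ i ∈ S, ∃ j ∈ S, i ≠ j ∧ f i = t ∧ f j = t) : 2 * T.ncard ≤ S.card := by
  classical
  rw [Set.ncard_eq_toFinset_card T (Set.toFinite T), mul_comm]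
  by_contra hlt
  obtain ⟨t, ht, hlt⟩ := Finset.exists_card_fiber_lt_of_card_lt_mul (f := f) (not_le.1 hlt)
  obtain ⟨i, hi, j, hj, hij, hit, hjt⟩ := h t (by simpa using ht)
  refine absurd (Finset.card_le_card (s := {i, j}) ?_) ((Finset.card_pair hij).symm ▸ hlt).not_ge
  simp [Finset.insert_subset_iff, hi, hj, hit, hjt]

lemma two_mul_ncard_lt_card_of_notMem {α β : Type*} [Finite β] {f : α → β} {S : Finset α}
    {T : Set β} (h : ∀ t ∈ T, ∃ i ∈ S, ∃ j ∈ S, i ≠ j ∧ f i = t ∧ f j = t) {i : α} (hi : i ∈ S)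
    (hiT : f i ∉ T) : 2 * T.ncard < S.card := by
  classical
  refine lt_of_le_of_lt (two_mul_ncard_le_card (f := f) (S := S.erase i) fun t ht => ?_)
    (Finset.card_erase_lt_of_mem hi)
  obtain ⟨a, ha, b, hb, hab, hat, hbt⟩ := h t ht
  exact ⟨a, Finset.mem_erase.2 ⟨by rintro rfl; exact hiT (hat ▸ ht), ha⟩, b,
    Finset.mem_erase.2 ⟨by rintro rfl; exact hiT (hbt ▸ ht), hb⟩, hab, hat, hbt⟩

lemma two_mul_ncard_lt_card_of_three {α β : Type*} [Finite β] {f : α → β} {S : Finset α}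
    {T : Set β} (h : ∀ t ∈ T, ∃ i ∈ S, ∃ j ∈ S, i ≠ j ∧ f i = t ∧ f j = t) {i j k : α}
    (hi : i ∈ S) (hj : j ∈ S) (hk : k ∈ S) (hij : i ≠ j) (hik : i ≠ k) (hjk : j ≠ k)
    (h1 : f j = f i) (h2 : f k = f i) : 2 * T.ncard < S.card := by
  classical
  refine lt_of_le_of_lt (two_mul_ncard_le_card (f := f) (S := S.erase k) fun t ht => ?_)
    (Finset.card_erase_lt_of_mem hk)
  by_cases hkt : f k = t
  · exact ⟨i, Finset.mem_erase.2 ⟨hik, hi⟩, j, Finset.mem_erase.2 ⟨hjk, hj⟩, hij,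
      h2.symm.trans hkt, (h1.trans h2.symm).trans hkt⟩
  · obtain ⟨a, ha, b, hb, hab, hat, hbt⟩ := h t ht
    exact ⟨a, Finset.mem_erase.2 ⟨by rintro rfl; exact hkt hat, ha⟩, b,
      Finset.mem_erase.2 ⟨by rintro rfl; exact hkt hbt, hb⟩, hab, hat, hbt⟩

section points
variable {m : ℕ}

lemma left_ne_right (i j : Fin m) : left i ≠ right j := by
  intro h; have := congrArg Fin.val h; simp only [left, right] at this; omega

lemma left_lt_right (i j : Fin m) : left i < right j := by
  rw [Fin.lt_def]; simp only [left, right]; omega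

@[simp] lemma left_lt_left {i j : Fin m} : left i < left j ↔ i < j := Iff.rfl

@[simp] lemma right_lt_right {i j : Fin m} : right i < right j ↔ j < i := by
  rw [Fin.lt_def, Fin.lt_def]; simp only [right]; omega

lemma left_injective : Function.Injective (left (m := m)) := fun i j h => by
  simpa [left, Fin.ext_iff] using h

lemma right_injective : Function.Injective (right (m := m)) := fun i j h => by
  rw [Fin.ext_iff] at h ⊢; simp only [right] at h; omega

@[simp] lemma left_inj {i j : Fin m} : left i = left j ↔ i = j := left_injective.eq_iff

@[simp] lemma right_inj {i j : Fin m} : right i = right j ↔ i = j := right_injective.eq_iff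

lemma left_or_right (a : Fin (2 * m)) : (∃ i, a = left i) ∨ ∃ i, a = right i := by
  by_cases h : a.1 < m
  · exact Or.inl ⟨⟨a, h⟩, rfl⟩
  · refine Or.inr ⟨⟨2 * m - 1 - a, by omega⟩, ?_⟩
    rw [Fin.ext_iff]; simp only [right]; omega

end points

section glue
variable {m : ℕ} {D : Fin (2 * m) → Fin (2 * m)} {v : Fin m → Fin m}

lemma glue_adj {a b : Fin (2 * m)} : (glue D v).Adj a b ↔ a ≠ b ∧
    ((D a = b ∨ ∃ i, a = right i ∧ b = right (v i)) ∨
      (D b = a ∨ ∃ i, b = right i ∧ a = right (v i))) := by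
  rw [glue, SimpleGraph.fromRel_adj]

lemma glue_reachable_diagram (a : Fin (2 * m)) : (glue D v).Reachable a (D a) := by
  by_cases h : a = D a
  · rw [← h]
  · exact (glue_adj.2 ⟨h, Or.inl (Or.inl rfl)⟩).reachable

lemma glue_reachable_link (i : Fin m) : (glue D v).Reachable (right i) (right (v i)) := by
  by_cases h : right i = right (v i)
  · rw [← h]
  · exact (glue_adj.2 ⟨h, Or.inl (Or.inr ⟨i, rfl, rfl⟩)⟩).reachable

/-- The set of loops counted by `loops`. -/
def loopSet (D : Fin (2 * m) → Fin (2 * m)) (v : Fin m → Fin m) :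
    Set (glue D v).ConnectedComponent :=
  {c | ∀ a, (glue D v).connectedComponentMk a = c → ∃ i, a = right i ∧ v i ≠ i}

lemma loops_eq_ncard : loops D v = (loopSet D v).ncard := rfl

/-- Every loop contains an arc of the link state. -/
lemma exists_pair_of_mem_loopSet (hv : ∀ i, v (v i) = i) {c : (glue D v).ConnectedComponent}
    (hc : c ∈ loopSet D v) :
    ∃ i ∈ Finset.univ.filter (fun i => v i ≠ i), ∃ j ∈ Finset.univ.filter (fun i => v i ≠ i),
      i ≠ j ∧ (glue D v).connectedComponentMk (right i) = c ∧
        (glue D v).connectedComponentMk (right j) = c := by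
  obtain ⟨a, rfl⟩ := c.exists_rep
  obtain ⟨i, rfl, hi⟩ := hc a rfl
  refine ⟨i, by simpa using hi, v i, by simpa [hv] using hi.symm, hi.symm, rfl, ?_⟩
  exact SimpleGraph.ConnectedComponent.eq.2 (glue_reachable_link i).symm

/-- Every loop contains an arc of the diagram that joins two points of the right line. -/
lemma exists_diagram_pair_of_mem_loopSet (hD : ∀ a, D (D a) = a) (hD' : ∀ a, D a ≠ a)
    {c : (glue D v).ConnectedComponent} (hc : c ∈ loopSet D v) :
    ∃ i ∈ Finset.univ.filter (fun i => ∃ j, D (right i) = right j),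
      ∃ j ∈ Finset.univ.filter (fun i => ∃ j, D (right i) = right j),
      i ≠ j ∧ (glue D v).connectedComponentMk (right i) = c ∧
        (glue D v).connectedComponentMk (right j) = c := by
  obtain ⟨a, rfl⟩ := c.exists_rep
  obtain ⟨i, rfl, -⟩ := hc a rfl
  have hr : (glue D v).connectedComponentMk (D (right i)) =
      (glue D v).connectedComponentMk (right i) :=
    SimpleGraph.ConnectedComponent.eq.2 (glue_reachable_diagram _).symm
  obtain ⟨j, hj, -⟩ := hc _ hr
  refine ⟨i, by simp [hj], j, by simp [← hj, hD], ?_, rfl, hj ▸ hr⟩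
  rintro rfl
  exact hD' _ hj

lemma two_mul_loops_le (hv : ∀ i, v (v i) = i) :
    2 * loops D v ≤ (Finset.univ.filter fun i => v i ≠ i).card :=
  two_mul_ncard_le_card (fun _ => exists_pair_of_mem_loopSet hv)

lemma two_mul_loops_le_diagram (hD : ∀ a, D (D a) = a) (hD' : ∀ a, D a ≠ a) :
    2 * loops D v ≤ (Finset.univ.filter fun i => ∃ j, D (right i) = right j).card :=
  two_mul_ncard_le_card (fun _ => exists_diagram_pair_of_mem_loopSet hD hD')

/-- If every arc of the link state yields a loop of its own, then the diagram contains the mirror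
image of each of these arcs. -/
lemma diagram_right_of_loops_eq (hv : ∀ i, v (v i) = i) (hD' : ∀ a, D a ≠ a)
    (h : 2 * loops D v = (Finset.univ.filter fun i => v i ≠ i).card) {i : Fin m} (hi : v i ≠ i) :
    D (right i) = right (v i) := by
  have hmem {j : Fin m} : v j ≠ j → j ∈ Finset.univ.filter fun i => v i ≠ i := fun hj => by simpa
  have hc : (glue D v).connectedComponentMk (right i) ∈ loopSet D v := by
    by_contra hc
    exact (two_mul_ncard_lt_card_of_notMem (fun _ => exists_pair_of_mem_loopSet hv)
      (f := fun i => (glue D v).connectedComponentMk (right i)) (hmem hi) hc).ne h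
  have hr : (glue D v).connectedComponentMk (D (right i)) =
      (glue D v).connectedComponentMk (right i) :=
    SimpleGraph.ConnectedComponent.eq.2 (glue_reachable_diagram _).symm
  obtain ⟨j, hj, hjv⟩ := hc _ hr
  rw [hj]
  by_contra hne
  refine (two_mul_ncard_lt_card_of_three (fun _ => exists_pair_of_mem_loopSet hv)
    (f := fun i => (glue D v).connectedComponentMk (right i)) (hmem hi)
    (hmem (j := v i) (by rw [hv]; exact hi.symm)) (hmem hjv) hi.symm ?_ ?_ ?_ (hj ▸ hr)).ne h
  · rintro rfl; exact hD' _ hj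
  · rintro h; exact hne (h ▸ rfl)
  · exact SimpleGraph.ConnectedComponent.eq.2 (glue_reachable_link i).symm

lemma glue_reachable_iff (hD : ∀ a, D (D a) = a)
    (h : ∀ i, v i ≠ i → D (right i) = right (v i)) {a b : Fin (2 * m)} :
    (glue D v).Reachable a b ↔ b = a ∨ b = D a := by
  constructor
  · rintro ⟨w⟩
    induction w with
    | nil => exact Or.inl rfl
    | @cons a c b hadj w ih =>
      obtain ⟨hne, hadj⟩ := glue_adj.1 hadj
      have hc : c = D a := by
        rcases hadj with (h1 | ⟨i, rfl, rfl⟩) | (h1 | ⟨i, rfl, rfl⟩)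
        · exact h1.symm
        · rw [h i fun h => hne (by rw [h])]
        · rw [← h1, hD]
        · rw [← h i fun h => hne (by rw [h]), hD]
      subst hc
      rw [hD] at ih
      exact ih.symm
  · rintro (rfl | rfl)
    · exact SimpleGraph.Reachable.refl _
    · exact glue_reachable_diagram _

/-- If the diagram contains the mirror images of all arcs of the link state, then every arc yields
a loop of its own. -/
lemma loops_eq_of_diagram_right (hv : ∀ i, v (v i) = i) (hD : ∀ a, D (D a) = a)
    (h : ∀ i, v i ≠ i → D (right i) = right (v i)) :
    2 * loops D v = (Finset.univ.filter fun i => v i ≠ i).card := by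
  classical
  have hr := fun a b => glue_reachable_iff (D := D) (v := v) hD h (a := a) (b := b)
  rw [loops_eq_ncard, Set.ncard_eq_toFinset_card _ (Set.toFinite _)]
  rw [Finset.card_eq_sum_card_fiberwise
    (f := fun i => (glue D v).connectedComponentMk (right i))
    (t := (Set.toFinite (loopSet D v)).toFinset)]
  · rw [Finset.sum_const_nat (m := 2), mul_comm]
    intro c hc
    rw [Set.Finite.mem_toFinset] at hc
    obtain ⟨a, rfl⟩ := c.exists_rep
    obtain ⟨i, rfl, hi⟩ := hc a rfl
    refine Eq.trans (congrArg Finset.card ?_) (Finset.card_pair hi.symm)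
    ext j
    simp only [Finset.mem_filter, Finset.mem_univ, true_and, Finset.mem_insert,
      Finset.mem_singleton]
    constructor
    · rintro ⟨-, h2⟩
      rcases (hr _ _).1 (SimpleGraph.ConnectedComponent.eq.1 h2).symm with h3 | h3
      · exact Or.inl (right_injective h3)
      · rw [h i hi] at h3
        exact Or.inr (right_injective h3)
    · rintro (rfl | rfl)
      · exact ⟨hi, rfl⟩
      · exact ⟨by rw [hv]; exact hi.symm,
          SimpleGraph.ConnectedComponent.eq.2 (glue_reachable_link i).symm⟩
  · intro i hi
    have hi : v i ≠ i := by simpa using hi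
    simp only [Set.Finite.coe_toFinset]
    intro a ha
    rcases (hr _ _).1 (SimpleGraph.ConnectedComponent.eq.1 ha).symm with rfl | rfl
    · exact ⟨i, rfl, hi⟩
    · exact ⟨v i, h i hi, by rw [hv]; exact hi.symm⟩

/-- `D` consists of the arcs of `x` on the left line, those of `y` on the right line, and strands
that join the defects of `x` to those of `y`. -/
def Joins (D : Fin (2 * m) → Fin (2 * m)) (x y : Fin m → Fin m) : Prop :=
  (∀ i, x i ≠ i → D (left i) = left (x i)) ∧ (∀ i, y i ≠ i → D (right i) = right (y i)) ∧
    ∀ i, x i = i → ∃ j, y j = j ∧ D (left i) = right j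

/-- The entries of a standard module that are of leading order in the loop parameter come from the
diagrams `|x⟩⟨y|`. -/
lemma isResult_and_loops_iff_joins {x y : Fin m → Fin m} (hy : ∀ i, y (y i) = i)
    (hD : ∀ a, D (D a) = a) (hD' : ∀ a, D a ≠ a) :
    IsResult D y x ∧ 2 * loops D y = (Finset.univ.filter fun i => y i ≠ i).card ↔
      Joins D x y := by
  constructor
  · rintro ⟨h1, h2⟩
    have h3 : ∀ i, y i ≠ i → D (right i) = right (y i) := fun i =>
      diagram_right_of_loops_eq hy hD' h2
    have hr := fun a b => glue_reachable_iff (D := D) (v := y) hD h3 (a := a) (b := b)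
    refine ⟨fun i hi => ?_, h3, fun i hi => ?_⟩
    · rcases (hr _ _).1 ((h1 i).2 hi) with h | h
      · exact absurd (left_injective h) hi
      · exact h.symm
    · obtain ⟨j, hj, h⟩ := (h1 i).1 hi
      rcases (hr _ _).1 h with h | h
      · exact absurd h.symm (left_ne_right _ _)
      · exact ⟨j, hj, h.symm⟩
  · rintro ⟨h1, h2, h3⟩
    refine ⟨fun i => ⟨fun hi => ?_, fun hi => ?_⟩, loops_eq_of_diagram_right hy hD h2⟩
    · obtain ⟨j, hj, h⟩ := h3 i hi
      exact ⟨j, hj, h ▸ glue_reachable_diagram _⟩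
    · exact h1 i hi ▸ glue_reachable_diagram _

end glue

/-! ### Non-crossing permutations and planar diagrams -/

/-- An arc encloses an even number of points, so its ends have different parity. -/
lemma IsPlanar.parity_ne {n d : ℕ} {v : Fin n → Fin n} (hv : IsPlanar d v) {i : Fin n}
    (hi : v i ≠ i) : (v i).1 % 2 ≠ i.1 % 2 := by
  have key : ∀ i, i < v i → (v i).1 % 2 ≠ i.1 % 2 := by
    intro i hi
    have h : ∑ j ∈ Finset.Ioo i (v i), (1 : ZMod 2) = 0 := by
      refine Finset.sum_involution (fun j _ => v j) (fun _ _ => by decide) ?_ ?_ ?_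
      · intro j hj _
        rw [Finset.mem_Ioo] at hj
        exact hv.2.2.1 i j hj.1 hj.2
      · intro j hj
        rw [Finset.mem_Ioo] at hj ⊢
        exact hv.2.1 i j hj.1 hj.2
      · intro j _
        exact hv.1 j
    rw [Finset.sum_const, nsmul_one, Fin.card_Ioo, ZMod.natCast_eq_zero_iff] at h
    have := Fin.lt_def.1 hi
    omega
  rcases lt_or_gt_of_ne hi with h | h
  · have := key (v i) (by rwa [hv.1])
    rw [hv.1] at this
    exact this.symm
  · exact key i h

lemma isPlanar_zero_of_noFixed {n : ℕ} {v : Fin n → Fin n} (h1 : ∀ i, v (v i) = i)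
    (h2 : ∀ i, v i ≠ i) (h3 : ∀ i j, i < j → j < v i → i < v j ∧ v j < v i) : IsPlanar 0 v :=
  ⟨h1, h3, fun _ j _ _ => h2 j, by simp [h2]⟩

lemma IsPlanar.ne_self {n : ℕ} {v : Fin n → Fin n} (hv : IsPlanar 0 v) (i : Fin n) : v i ≠ i := by
  have := hv.2.2.2
  rw [Finset.card_eq_zero, Finset.filter_eq_empty_iff] at this
  exact this (Finset.mem_univ i)

section doubleLine
variable {m : ℕ}

/-- The incoming line of `i`. -/
def inLine (i : Fin m) : Fin (2 * m) := ⟨2 * i, by omega⟩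

/-- The outgoing line of `i`. -/
def outLine (i : Fin m) : Fin (2 * m) := ⟨2 * i + 1, by omega⟩

lemma in_or_out (a : Fin (2 * m)) : (∃ i, a = inLine i) ∨ ∃ i, a = outLine i := by
  rcases Nat.mod_two_eq_zero_or_one a with h | h
  · exact Or.inl ⟨⟨a / 2, by omega⟩, by rw [Fin.ext_iff]; simp only [inLine]; omega⟩
  · exact Or.inr ⟨⟨a / 2, by omega⟩, by rw [Fin.ext_iff]; simp only [outLine]; omega⟩

@[simp] lemma inLine_inj {i j : Fin m} : inLine i = inLine j ↔ i = j := by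
  simp only [Fin.ext_iff, inLine]; omega

@[simp] lemma outLine_inj {i j : Fin m} : outLine i = outLine j ↔ i = j := by
  simp only [Fin.ext_iff, outLine]; omega

lemma inLine_ne_outLine (i j : Fin m) : inLine i ≠ outLine j := by
  simp only [ne_eq, Fin.ext_iff, outLine, inLine]; omega

@[simp] lemma doubleLine_outLine (h : Equiv.Perm (Fin m)) (i : Fin m) :
    doubleLine h (outLine i) = inLine (h i) := by
  have e : (⟨(2 * i.1 + 1) / 2, by omega⟩ : Fin m) = i := by rw [Fin.ext_iff]; simp only []; omega
  simp [doubleLine, outLine, inLine, e]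

@[simp] lemma doubleLine_inLine (h : Equiv.Perm (Fin m)) (i : Fin m) :
    doubleLine h (inLine i) = outLine (h.symm i) := by
  simp [doubleLine, outLine, inLine]

lemma doubleLine_injective : Function.Injective (doubleLine (m := m)) := by
  intro h h' e
  ext1 i
  have := congrFun e (outLine i)
  simpa using this

lemma doubleLine_doubleLine (h : Equiv.Perm (Fin m)) (a : Fin (2 * m)) :
    doubleLine h (doubleLine h a) = a := by
  rcases in_or_out a with ⟨i, rfl⟩ | ⟨i, rfl⟩ <;> simp

lemma doubleLine_ne_self (h : Equiv.Perm (Fin m)) (a : Fin (2 * m)) : doubleLine h a ≠ a := by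
  rcases in_or_out a with ⟨i, rfl⟩ | ⟨i, rfl⟩
  · rw [doubleLine_inLine]; exact (inLine_ne_outLine _ _).symm
  · rw [doubleLine_outLine]; exact inLine_ne_outLine _ _

lemma exists_doubleLine_eq {D : Fin (2 * m) → Fin (2 * m)} (hD : IsPlanar 0 D) :
    ∃ h : Equiv.Perm (Fin m), doubleLine h = D := by
  have hout (i : Fin m) : ∃ j, D (outLine i) = inLine j := by
    rcases in_or_out (D (outLine i)) with h | ⟨j, h⟩
    · exact h
    · have := hD.parity_ne (hD.ne_self (outLine i))
      rw [h] at this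
      simp only [outLine] at this; omega
  have hin (i : Fin m) : ∃ j, D (inLine i) = outLine j := by
    rcases in_or_out (D (inLine i)) with ⟨j, h⟩ | h
    · have := hD.parity_ne (hD.ne_self (inLine i))
      rw [h] at this
      simp only [inLine] at this; omega
    · exact h
  choose f hf using hout
  choose f' hf' using hin
  refine ⟨⟨f, f', fun i => ?_, fun i => ?_⟩, funext fun a => ?_⟩
  · have := hf' (f i)
    rw [← hf, hD.1] at this
    exact (outLine_inj.1 this).symm
  · have := hf (f' i)
    rw [← hf', hD.1] at this
    exact (inLine_inj.1 this).symm
  · rcases in_or_out a with ⟨i, rfl⟩ | ⟨i, rfl⟩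
    · rw [doubleLine_inLine, hf']; rfl
    · rw [doubleLine_outLine, hf]; rfl

lemma sameCycle_symm_apply (h : Equiv.Perm (Fin m)) (i : Fin m) : h.SameCycle i (h.symm i) :=
  Equiv.Perm.sameCycle_symm_apply_right.2 (Equiv.Perm.SameCycle.refl _ _)

lemma sameCycle_apply (h : Equiv.Perm (Fin m)) (i : Fin m) : h.SameCycle i (h i) :=
  Equiv.Perm.sameCycle_apply_right.2 (Equiv.Perm.SameCycle.refl _ _)

lemma mem_of_sameCycle {h : Equiv.Perm (Fin m)} {S : Set (Fin m)} (hS : ∀ i ∈ S, h i ∈ S)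
    {i j : Fin m} (hij : h.SameCycle i j) (hi : i ∈ S) : j ∈ S := by
  obtain ⟨n, rfl⟩ := hij.exists_nat_pow_eq
  clear hij
  induction n with
  | zero => simpa using hi
  | succ n ih => rw [pow_succ', Equiv.Perm.mul_apply]; exact hS _ ih

lemma isPlanar_doubleLine {h : Equiv.Perm (Fin m)} (hh : IsNoncrossing h) :
    IsPlanar 0 (doubleLine h) := by
  obtain ⟨h1, h2, h3⟩ := hh
  refine isPlanar_zero_of_noFixed (doubleLine_doubleLine h) (doubleLine_ne_self h) ?_
  intro a b hab hb
  -- it suffices to locate the element that carries the other end of the strand from `b`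
  obtain ⟨f, f', hf, hff, hf'⟩ : ∃ f f' : Fin m, b.1 / 2 = f ∧ h.SameCycle f f' ∧
      (doubleLine h b).1 / 2 = f' := by
    rcases in_or_out b with ⟨i, rfl⟩ | ⟨i, rfl⟩
    · refine ⟨i, h.symm i, ?_, sameCycle_symm_apply h i, ?_⟩
      · simp only [inLine]; omega
      · rw [doubleLine_inLine]; simp only [outLine]; omega
    · refine ⟨i, h i, ?_, sameCycle_apply h i, ?_⟩
      · simp only [outLine]; omega
      · rw [doubleLine_outLine]; simp only [inLine]; omega
  have hinj : Function.Injective (doubleLine h) :=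
    (show Function.Involutive (doubleLine h) from doubleLine_doubleLine h).injective
  have hn1 : doubleLine h b ≠ a := by
    intro e
    rw [← e, doubleLine_doubleLine] at hb
    exact lt_irrefl _ hb
  have hn2 : doubleLine h b ≠ doubleLine h a := fun e => hab.ne' (hinj e)
  rw [ne_eq, Fin.ext_iff] at hn1 hn2
  rw [Fin.lt_def] at hab hb
  rw [Fin.lt_def, Fin.lt_def]
  rcases in_or_out a with ⟨e, rfl⟩ | ⟨e, rfl⟩
  · rw [doubleLine_inLine] at hb hn2 ⊢
    obtain ⟨c, rfl⟩ := h.surjective e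
    rw [Equiv.symm_apply_apply] at hb hn2 ⊢
    simp only [inLine, outLine] at hab hb hn1 hn2 ⊢
    have hec : h c ≤ c := by rw [Fin.le_def]; omega
    have hcyc := fun j hj => h3 c j hj hec
    by_cases hs : h.SameCycle c f
    · have := hcyc f' (hs.trans hff)
      simp only [Fin.le_def] at this
      omega
    · have hs' : ¬ h.SameCycle c f' := fun h' => hs (h'.trans hff.symm)
      have e1 : f ≠ c := by rintro rfl; exact hs (.refl _ _)
      have e2 : f ≠ h c := by rintro rfl; exact hs (sameCycle_apply h c)
      have e3 : f' ≠ c := by rintro rfl; exact hs' (.refl _ _)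
      have e4 : f' ≠ h c := by rintro rfl; exact hs' (sameCycle_apply h c)
      rw [ne_eq, Fin.ext_iff] at e1 e2 e3 e4
      have g1 : h c ≤ f' := by
        by_contra hlt
        exact hs ((sameCycle_apply h c).trans (h1 f' (h c) f c (by simpa using hlt)
          (by rw [Fin.lt_def]; omega) (by rw [Fin.lt_def]; omega) hff.symm
          (sameCycle_apply h c).symm |>.symm.trans hff.symm))
      have g2 : f' ≤ c := by
        by_contra hlt
        exact hs ((sameCycle_apply h c).trans (h1 (h c) f c f' (by rw [Fin.lt_def]; omega)
          (by rw [Fin.lt_def]; omega) (by simpa using hlt) (sameCycle_apply h c).symm hff))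
      rw [Fin.le_def] at g1 g2
      omega
  · rw [doubleLine_outLine] at hb hn2 ⊢
    simp only [inLine, outLine] at hab hb hn1 hn2 ⊢
    have hec : e < h e := by rw [Fin.lt_def]; omega
    have hs : ¬ h.SameCycle e f := by
      intro hs
      have := h2 e f hs hec
      simp only [Fin.le_def] at this
      omega
    have hs' : ¬ h.SameCycle e f' := fun h' => hs (h'.trans hff.symm)
    have e3 : f' ≠ e := by rintro rfl; exact hs' (.refl _ _)
    have e4 : f' ≠ h e := by rintro rfl; exact hs' (sameCycle_apply h e)
    rw [ne_eq, Fin.ext_iff] at e3 e4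
    have g1 : e ≤ f' := by
      by_contra hlt
      exact hs' (h1 f' e f (h e) (by simpa using hlt)
          (by rw [Fin.lt_def]; omega) (by rw [Fin.lt_def]; omega) hff.symm
          (sameCycle_apply h e)).symm
    have g2 : f' ≤ h e := by
      by_contra hlt
      exact hs (h1 e f (h e) f' (by rw [Fin.lt_def]; omega)
          (by rw [Fin.lt_def]; omega) (by simpa using hlt) (sameCycle_apply h e) hff)
    rw [Fin.le_def] at g1 g2
    omega

lemma isNoncrossing_of_isPlanar {h : Equiv.Perm (Fin m)} (hD : IsPlanar 0 (doubleLine h)) :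
    IsNoncrossing h := by
  -- the elements strictly between `e` and `h e` form a union of cycles
  have hopen : ∀ e f f', e < h e → h.SameCycle f f' → e < f → f < h e → e < f' ∧ f' < h e := by
    intro e f f' he hff h1 h2
    refine mem_of_sameCycle (S := {f | e < f ∧ f < h e}) ?_ hff ⟨h1, h2⟩
    rintro f ⟨h1, h2⟩
    have := hD.2.1 (outLine e) (outLine f)
    rw [doubleLine_outLine, doubleLine_outLine] at this
    simp only [Fin.lt_def, inLine, outLine, Set.mem_ofPred_eq] at this h1 h2 ⊢
    omega
  have hclosed : ∀ e f f', h e ≤ e → h.SameCycle f f' → h e ≤ f → f ≤ e → h e ≤ f' ∧ f' ≤ e := by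
    intro e f f' he hff h1 h2
    refine mem_of_sameCycle (S := {f | h e ≤ f ∧ f ≤ e}) ?_ hff ⟨h1, h2⟩
    rintro f ⟨h1, h2⟩
    rcases eq_or_lt_of_le h2 with rfl | h2
    · exact ⟨le_rfl, h1⟩
    have := hD.2.1 (inLine (h e)) (outLine f)
    rw [doubleLine_inLine, doubleLine_outLine, Equiv.symm_apply_apply] at this
    simp only [Fin.lt_def, Fin.le_def, inLine, outLine, Set.mem_ofPred_eq] at this h1 h2 ⊢
    omega
  refine ⟨fun a b c d hab hbc hcd hac hbd => ?_, fun i j hij hi => ?_, fun i j hij hi => ?_⟩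
  · by_contra hne
    -- the cycle of `a` and `c` jumps over `b`
    obtain ⟨e, hae, heb, hbe⟩ : ∃ e, h.SameCycle a e ∧ e < b ∧ b ≤ h e := by
      by_contra hcon
      push Not at hcon
      have := mem_of_sameCycle (S := {e | h.SameCycle a e ∧ e < b})
        (fun e he => ⟨he.1.trans (sameCycle_apply h e), hcon e he.1 he.2⟩) hac ⟨.refl _ _, hab⟩
      exact lt_asymm hbc this.2
    have hbe' : b < h e := lt_of_le_of_ne hbe (by
      rintro rfl; exact hne (hae.trans (sameCycle_apply h e)))
    have hd := hopen e b d (heb.trans hbe') hbd heb hbe'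
    have := hopen e c e (heb.trans hbe') (hac.symm.trans hae) (heb.trans hbc) (hcd.trans hd.2)
    exact lt_irrefl _ this.1
  · by_contra hcon
    push Not at hcon
    exact lt_irrefl _ (hopen i j i hi hij.symm hcon.1 hcon.2).1
  · exact hclosed i i j hi hij hi le_rfl

/-- A cycle is counted through its smallest element `i`, which is the one with `i ≤ h⁻¹ i`; in the
diagram this is a strand that opens at an even position. -/
lemma numCycles_eq_card {h : Equiv.Perm (Fin m)} (hh : IsNoncrossing h) :
    numCycles h = (Finset.univ.filter fun a => a.1 % 2 = 0 ∧ a < doubleLine h a).card := by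
  have h1 : numCycles h = Nat.card {i : Fin m // i ≤ h.symm i} := by
    symm
    refine Nat.card_eq_of_bijective
      (fun i => (Quotient.mk (Equiv.Perm.SameCycle.setoid h) i.1)) ⟨?_, ?_⟩
    · have key : ∀ i j : Fin m, i ≤ h.symm i → h.SameCycle i j → i ≤ j := by
        intro i j hi hij
        have := (hh.2.2 (h.symm i) j ((sameCycle_symm_apply h i).symm.trans hij) (by simpa)).1
        simpa using this
      rintro ⟨i, hi⟩ ⟨j, hj⟩ hij
      have hij : h.SameCycle i j := Quotient.exact hij
      exact Subtype.ext (le_antisymm (key i j hi hij) (key j i hj hij.symm))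
    · intro c
      obtain ⟨i, rfl⟩ := c.exists_rep
      have hne : (Set.toFinite {j | h.SameCycle i j}).toFinset.Nonempty :=
        ⟨i, by rw [Set.Finite.mem_toFinset]; exact .refl _ _⟩
      have hmem := Finset.min'_mem _ hne
      rw [Set.Finite.mem_toFinset] at hmem
      refine ⟨⟨Finset.min' _ hne, Finset.min'_le _ _ ?_⟩, Quotient.sound hmem.symm⟩
      rw [Set.Finite.mem_toFinset]
      exact hmem.trans (sameCycle_symm_apply h _)
  rw [h1, Nat.card_eq_fintype_card, Fintype.card_subtype]
  refine Finset.card_nbij inLine ?_ ?_ ?_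
  · intro i hi
    have hi : i ≤ h.symm i := by simpa using hi
    refine Finset.mem_coe.2 (Finset.mem_filter.2 ⟨Finset.mem_univ _, ?_⟩)
    rw [doubleLine_inLine]
    simp only [Fin.lt_def, Fin.le_def, inLine, outLine] at hi ⊢
    omega
  · intro i _ j _ hij
    exact inLine_inj.1 hij
  · intro a ha
    simp only [Finset.coe_filter, Finset.mem_univ, true_and, Set.mem_ofPred_eq] at ha
    rcases in_or_out a with ⟨i, rfl⟩ | ⟨i, rfl⟩
    · refine ⟨i, ?_, rfl⟩
      rw [doubleLine_inLine] at ha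
      simp only [Finset.coe_filter, Finset.mem_univ, true_and, Set.mem_ofPred_eq]
      simp only [Fin.lt_def, Fin.le_def, inLine, outLine] at ha ⊢
      omega
    · simp only [outLine] at ha
      omega

end doubleLine

/-! ### The diagrams `|x⟩⟨y|` -/

section ketbra
variable {m : ℕ}

/-- The two lines together make up all boundary points. -/
noncomputable def linesEquiv (m : ℕ) : Fin m ⊕ Fin m ≃ Fin (2 * m) :=
  Equiv.ofBijective (Sum.elim left right) ⟨by
    rintro (i | i) (j | j) h
    · exact congrArg _ (left_injective h)
    · exact absurd h (left_ne_right i j)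
    · exact absurd h.symm (left_ne_right j i)
    · exact congrArg _ (right_injective h), fun a => by
    rcases left_or_right a with ⟨i, rfl⟩ | ⟨i, rfl⟩
    · exact ⟨.inl i, rfl⟩
    · exact ⟨.inr i, rfl⟩⟩

lemma linesEquiv_symm_left (i : Fin m) : (linesEquiv m).symm (left i) = .inl i :=
  (linesEquiv m).symm_apply_eq.2 rfl

lemma linesEquiv_symm_right (i : Fin m) : (linesEquiv m).symm (right i) = .inr i :=
  (linesEquiv m).symm_apply_eq.2 rfl

lemma card_filter_lines (p : Fin (2 * m) → Prop) [DecidablePred p] :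
    (Finset.univ.filter p).card = (Finset.univ.filter fun i => p (left i)).card +
      (Finset.univ.filter fun i => p (right i)).card := by
  rw [Finset.card_filter, Finset.card_filter, Finset.card_filter, ← (linesEquiv m).sum_comp,
    Fintype.sum_sum_type]
  rfl

/-- In a planar arc system as many defects sit at even as at odd positions, if the number of points
is even: arcs join even to odd positions. -/
lemma card_even_defects {μ k : ℕ} {x : Fin (2 * μ) → Fin (2 * μ)} (hx : IsPlanar (2 * k) x) :
    (Finset.univ.filter fun i => i.1 % 2 = 0 ∧ x i = i).card = k := by
  set s : Fin (2 * μ) → ℤ := fun i => (-1) ^ i.1 with hs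
  have h1 : ∑ i with x i = i, s i = 0 := by
    have hall : ∑ i, s i = 0 := by
      rw [hs, Fin.sum_univ_eq_sum_range (fun i => (-1 : ℤ) ^ i) (2 * μ)]
      simp [neg_one_geom_sum]
    have harc : ∑ i with ¬ x i = i, s i = 0 := by
      refine Finset.sum_involution (fun i _ => x i) ?_ ?_ ?_ ?_
      · intro i hi
        have hi : x i ≠ i := by simpa using hi
        have := hx.parity_ne hi
        rcases Nat.mod_two_eq_zero_or_one i with h | h
        · rw [hs]
          simp only
          rw [Even.neg_one_pow (Nat.even_iff.2 h), Odd.neg_one_pow (Nat.odd_iff.2 (by omega))]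
          rfl
        · rw [hs]
          simp only
          rw [Odd.neg_one_pow (Nat.odd_iff.2 h), Even.neg_one_pow (Nat.even_iff.2 (by omega))]
          rfl
      · intro i hi _
        simpa using hi
      · intro i hi
        have hi : x i ≠ i := by simpa using hi
        simpa [hx.1] using hi.symm
      · intro i _
        exact hx.1 i
    rw [← Finset.sum_filter_add_sum_filter_not Finset.univ (fun i => x i = i), harc, add_zero]
      at hall
    exact hall
  have h2 : ∑ i with x i = i, (1 : ℤ) = 2 * k := by
    have := hx.2.2.2
    simp [this]
  have h3 : ∑ i with x i = i, (s i + 1) =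
      2 * (Finset.univ.filter fun i => i.1 % 2 = 0 ∧ x i = i).card := by
    rw [Finset.filter_and, Finset.inter_comm, ← Finset.filter_mem_eq_inter, Finset.card_filter,
      Nat.cast_sum, Finset.mul_sum]
    refine Finset.sum_congr rfl fun i _ => ?_
    rcases Nat.mod_two_eq_zero_or_one i with h | h
    · simp [hs, Even.neg_one_pow (Nat.even_iff.2 h), h]
    · simp [hs, Odd.neg_one_pow (Nat.odd_iff.2 h), h]
  rw [Finset.sum_add_distrib, h1, h2] at h3
  omega

lemma card_even_openings {n d : ℕ} {x : Fin n → Fin n} (hx : IsPlanar d x) :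
    (Finset.univ.filter fun i => i.1 % 2 = 0 ∧ i < x i).card = oddClosings x := by
  have hp (i : Fin n) (h : x i ≠ i) := hx.parity_ne h
  refine Finset.card_nbij' x x ?_ ?_ ?_ ?_
  · intro i hi
    have hi : i.1 % 2 = 0 ∧ i < x i := by simpa using hi
    have := hp i hi.2.ne'
    refine Finset.mem_coe.2 (Finset.mem_filter.2 ⟨Finset.mem_univ _, by omega, ?_⟩)
    rw [hx.1]; exact hi.2
  · intro i hi
    have hi : i.1 % 2 = 1 ∧ x i < i := by simpa using hi
    have := hp i hi.2.ne
    refine Finset.mem_coe.2 (Finset.mem_filter.2 ⟨Finset.mem_univ _, by omega, ?_⟩)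
    rw [hx.1]; exact hi.2
  · intro i _; exact hx.1 i
  · intro i _; exact hx.1 i

variable {k : ℕ} {D : Fin (2 * m) → Fin (2 * m)} {x y : Fin m → Fin m}

/-- All defects of `y` are met by the strands from the defects of `x`, as there are equally many. -/
lemma Joins.exists_left (h : Joins D x y) (hD : Function.Injective D) (hx : IsPlanar k x)
    (hy : IsPlanar k y) {j : Fin m} (hj : y j = j) : ∃ i, x i = i ∧ D (left i) = right j := by
  choose φ hφ using fun i : {i // x i = i} => h.2.2 i.1 i.2
  have hinj : Function.Injective fun i : {i // x i = i} => (⟨φ i, (hφ i).1⟩ : {j // y j = j}) := by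
    intro a b hab
    have hab : φ a = φ b := congrArg Subtype.val hab
    apply Subtype.ext
    apply left_injective
    apply hD
    rw [(hφ a).2, (hφ b).2, hab]
  have hcard : Fintype.card {i // x i = i} = Fintype.card {j // y j = j} := by
    rw [Fintype.card_subtype, Fintype.card_subtype, hx.2.2.2, hy.2.2.2]
  obtain ⟨i, hi⟩ := ((Fintype.bijective_iff_injective_and_card _).2 ⟨hinj, hcard⟩).2 ⟨j, hj⟩
  have hi : φ i = j := congrArg Subtype.val hi
  exact ⟨i.1, i.2, by rw [(hφ i).2, hi]⟩

lemma Joins.apply_left_eq_orderEmb (h : Joins D x y) (hD : IsPlanar 0 D) (hx : IsPlanar k x)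
    (hy : IsPlanar k y) (j : Fin k) :
    D (left (Finset.orderEmbOfFin _ hx.2.2.2 j)) = right (Finset.orderEmbOfFin _ hy.2.2.2 j) := by
  have hδ (j : Fin k) : x (Finset.orderEmbOfFin _ hx.2.2.2 j) = Finset.orderEmbOfFin _ hx.2.2.2 j :=
    (Finset.mem_filter.1 (Finset.orderEmbOfFin_mem _ hx.2.2.2 j)).2
  choose φ hφ using fun j : Fin k => h.2.2 _ (hδ j)
  rw [(hφ j).2]
  congr 1
  refine congrFun (Finset.orderEmbOfFin_unique hy.2.2.2 (f := φ) (fun j => ?_) ?_) j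
  · simp [(hφ j).1]
  · intro a b hab
    have h1 := hD.2.1 (left (Finset.orderEmbOfFin _ hx.2.2.2 a))
      (left (Finset.orderEmbOfFin _ hx.2.2.2 b)) (by simpa using hab)
    rw [(hφ a).2, (hφ b).2] at h1
    exact right_lt_right.1 (h1 (left_lt_right _ _)).2

/-- A planar diagram is determined by its two halves, as its through strands do not cross. -/
lemma Joins.unique {D' : Fin (2 * m) → Fin (2 * m)} (h : Joins D x y) (h' : Joins D' x y)
    (hD : IsPlanar 0 D) (hD' : IsPlanar 0 D') (hx : IsPlanar k x) (hy : IsPlanar k y) : D = D' := by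
  have hl : ∀ i, D (left i) = D' (left i) := by
    intro i
    by_cases hi : x i = i
    · have : i ∈ Set.range (Finset.orderEmbOfFin _ hx.2.2.2) := by
        rw [Finset.range_orderEmbOfFin]; simpa using hi
      obtain ⟨j, rfl⟩ := this
      rw [h.apply_left_eq_orderEmb hD hx hy, h'.apply_left_eq_orderEmb hD' hx hy]
    · rw [h.1 i hi, h'.1 i hi]
  funext a
  rcases left_or_right a with ⟨i, rfl⟩ | ⟨j, rfl⟩
  · exact hl i
  · by_cases hj : y j = j
    · obtain ⟨i, -, hi⟩ := h.exists_left hD.injective hx hy hj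
      rw [← hi, hD.1, hl, hD'.1]
    · rw [h.2.1 j hj, h'.2.1 j hj]

/-- An arc lies on one side of a defect. -/
lemma IsPlanar.lt_of_defect_lt (hx : IsPlanar k x) {i j : Fin m} (hi : x i = i) (hij : i < j) :
    i < x j := by
  by_contra hlt
  rcases eq_or_lt_of_le (not_lt.1 hlt) with h | h
  · rw [← h, hx.1] at hi
    exact hij.ne (h ▸ hi.symm)
  · exact hx.2.2.1 (x j) i h (by rwa [hx.1]) hi

/-- The diagram with halves `x` and `y`. -/
lemma exists_joins (hx : IsPlanar k x) (hy : IsPlanar k y) : ∃ D, IsPlanar 0 D ∧ Joins D x y := by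
  obtain ⟨φ, ψ, hφ, hψ, hφmono⟩ : ∃ φ ψ : Fin m → Fin m,
      (∀ i, x i = i → y (φ i) = φ i ∧ ψ (φ i) = i) ∧ (∀ j, y j = j → x (ψ j) = ψ j ∧ φ (ψ j) = j) ∧
      ∀ i i', x i = i → x i' = i' → i < i' → φ i < φ i' := by
    set e : {i // i ∈ Finset.univ.filter fun i => x i = i} ≃o
      {j // j ∈ Finset.univ.filter fun j => y j = j} :=
      (Finset.orderIsoOfFin _ hx.2.2.2).symm.trans (Finset.orderIsoOfFin _ hy.2.2.2)
    have mx {i} (hi : x i = i) : i ∈ Finset.univ.filter fun i => x i = i := by simpa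
    have my {i} (hi : y i = i) : i ∈ Finset.univ.filter fun i => y i = i := by simpa
    have px (a : {i // i ∈ Finset.univ.filter fun i => x i = i}) : x a = a :=
      (Finset.mem_filter.1 a.2).2
    have py (a : {i // i ∈ Finset.univ.filter fun i => y i = i}) : y a = a :=
      (Finset.mem_filter.1 a.2).2
    refine ⟨fun i => if h : x i = i then (e ⟨i, mx h⟩).1 else i,
      fun j => if h : y j = j then (e.symm ⟨j, my h⟩).1 else j, fun i hi => ?_, fun j hj => ?_,
      fun i i' hi hi' hii => ?_⟩
    · simp only [hi, dite_true]
      refine ⟨py _, ?_⟩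
      rw [dif_pos (py _)]
      simp
    · simp only [hj, dite_true]
      refine ⟨px _, ?_⟩
      rw [dif_pos (px _)]
      simp
    · simp only [hi, hi', dite_true]
      exact e.lt_iff_lt.2 hii
  have hψmono : ∀ j j', y j = j → y j' = j' → j < j' → ψ j < ψ j' := by
    intro j j' hj hj' hjj
    rcases lt_trichotomy (ψ j) (ψ j') with h | h | h
    · exact h
    · rw [← (hψ j hj).2, ← (hψ j' hj').2, h] at hjj
      exact absurd hjj (lt_irrefl _)
    · have := hφmono _ _ (hψ j' hj').1 (hψ j hj).1 h
      rw [(hψ j hj).2, (hψ j' hj').2] at this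
      exact absurd this hjj.not_gt
  set D : Fin (2 * m) → Fin (2 * m) := fun a => Sum.elim
    (fun i => if x i = i then right (φ i) else left (x i))
    (fun j => if y j = j then left (ψ j) else right (y j)) ((linesEquiv m).symm a) with hD
  have dl (i : Fin m) : D (left i) = if x i = i then right (φ i) else left (x i) := by
    simp [hD, linesEquiv_symm_left]
  have dr (j : Fin m) : D (right j) = if y j = j then left (ψ j) else right (y j) := by
    simp [hD, linesEquiv_symm_right]
  refine ⟨D, isPlanar_zero_of_noFixed ?_ ?_ ?_, fun i hi => by rw [dl, if_neg hi],
    fun j hj => by rw [dr, if_neg hj], fun i hi => ⟨φ i, (hφ i hi).1, by rw [dl, if_pos hi]⟩⟩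
  · intro a
    rcases left_or_right a with ⟨i, rfl⟩ | ⟨j, rfl⟩
    · by_cases hi : x i = i
      · rw [dl, if_pos hi, dr, if_pos (hφ i hi).1, (hφ i hi).2]
      · rw [dl, if_neg hi, dl, if_neg (by rw [hx.1]; exact Ne.symm hi), hx.1]
    · by_cases hj : y j = j
      · rw [dr, if_pos hj, dl, if_pos (hψ j hj).1, (hψ j hj).2]
      · rw [dr, if_neg hj, dr, if_neg (by rw [hy.1]; exact Ne.symm hj), hy.1]
  · intro a
    rcases left_or_right a with ⟨i, rfl⟩ | ⟨j, rfl⟩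
    · rw [dl]
      split_ifs with hi
      · exact (left_ne_right _ _).symm
      · simpa using hi
    · rw [dr]
      split_ifs with hj
      · exact left_ne_right _ _
      · simpa using hj
  · intro a b hab hb
    rcases left_or_right a with ⟨i, rfl⟩ | ⟨i, rfl⟩ <;>
    rcases left_or_right b with ⟨j, rfl⟩ | ⟨j, rfl⟩
    · rw [left_lt_left] at hab
      by_cases hi : x i = i
      · rw [dl i, if_pos hi]
        by_cases hj : x j = j
        · rw [dl j, if_pos hj]
          exact ⟨left_lt_right _ _, right_lt_right.2 (hφmono i j hi hj hab)⟩
        · rw [dl j, if_neg hj]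
          exact ⟨left_lt_left.2 (hx.lt_of_defect_lt hi hab), left_lt_right _ _⟩
      · rw [dl i, if_neg hi] at hb ⊢
        rw [left_lt_left] at hb
        rw [dl j, if_neg (hx.2.2.1 i j hab hb)]
        exact hx.2.1 i j hab hb
    · by_cases hi : x i = i
      · rw [dl i, if_pos hi] at hb ⊢
        rw [right_lt_right] at hb
        by_cases hj : y j = j
        · rw [dr j, if_pos hj]
          refine ⟨left_lt_left.2 ?_, left_lt_right _ _⟩
          have := hψmono _ _ (hφ i hi).1 hj hb
          rwa [(hφ i hi).2] at this
        · rw [dr j, if_neg hj]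
          exact ⟨left_lt_right _ _, right_lt_right.2 (hy.lt_of_defect_lt (hφ i hi).1 hb)⟩
      · rw [dl i, if_neg hi] at hb
        exact absurd hb (left_lt_right _ _).not_gt
    · exact absurd hab (left_lt_right _ _).not_gt
    · rw [right_lt_right] at hab
      by_cases hi : y i = i
      · rw [dr i, if_pos hi] at hb
        exact absurd hb (left_lt_right _ _).not_gt
      · rw [dr i, if_neg hi] at hb ⊢
        rw [right_lt_right] at hb
        have hb' : j < y (y i) := by rwa [hy.1]
        have := hy.2.1 (y i) j hb hb'
        rw [hy.1] at this
        rw [dr j, if_neg (hy.2.2.1 (y i) j hb hb'), right_lt_right, right_lt_right]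
        exact this.symm

end ketbra

/-- The `2 * k` through strands of `|x⟩⟨y|` bound `k` shaded regions between them; every other
shaded region is cut off by an arc of one of the halves. -/
lemma Joins.numCycles_eq {μ k : ℕ} {x y : Fin (2 * μ) → Fin (2 * μ)}
    {h : Equiv.Perm (Fin (2 * μ))} (hh : IsNoncrossing h) (hj : Joins (doubleLine h) x y)
    (hx : IsPlanar (2 * k) x) (hy : IsPlanar (2 * k) y) :
    numCycles h = k + oddClosings x + oddClosings y := by
  have hD := isPlanar_doubleLine hh
  rw [numCycles_eq_card hh, card_filter_lines]
  congr 1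
  · rw [← card_even_defects hx, ← card_even_openings hx, ← Finset.card_union_of_disjoint]
    · congr 1
      ext i
      simp only [Finset.mem_filter, Finset.mem_univ, true_and, Finset.mem_union]
      have hl : (left i).1 = i.1 := rfl
      rw [hl]
      by_cases hi : x i = i
      · obtain ⟨j, -, h2⟩ := hj.2.2 i hi
        simp [h2, hi, left_lt_right]
      · simp [hj.1 i hi, hi]
    · rw [Finset.disjoint_filter]
      rintro i - ⟨-, h1⟩ ⟨-, h2⟩
      exact h2.ne' h1
  · rw [oddClosings]
    congr 1
    ext j
    simp only [Finset.mem_filter, Finset.mem_univ, true_and]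
    have hr : (right j).1 % 2 = 0 ↔ j.1 % 2 = 1 := by simp only [right]; omega
    rw [hr]
    by_cases hjj : y j = j
    · obtain ⟨i, -, hi⟩ := hj.exists_left hD.injective hx hy hjj
      rw [← hi, hD.1, hi, hjj]
      simp [(left_lt_right i j).not_gt]
    · rw [hj.2.1 j hjj, right_lt_right]

lemma existsUnique_noncrossing_joins {m k : ℕ} {x y : Fin m → Fin m} (hx : IsPlanar k x)
    (hy : IsPlanar k y) :
    ∃! h : Equiv.Perm (Fin m), IsNoncrossing h ∧ Joins (doubleLine h) x y := by
  obtain ⟨D, hD, hj⟩ := exists_joins hx hy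
  obtain ⟨h, rfl⟩ := exists_doubleLine_eq hD
  exact ⟨h, ⟨isNoncrossing_of_isPlanar hD, hj⟩, fun h' hh' =>
    doubleLine_injective (hh'.2.unique hj (isPlanar_doubleLine hh'.1) hD hx hy)⟩

/-! ### Multiplicities -/

section closure
variable {m d : ℕ} {D : Fin (2 * m) → Fin (2 * m)} {x v : Fin m → Fin m}

lemma Joins.apply_left_defect (h : Joins D x x) (hD : IsPlanar 0 D) (hx : IsPlanar d x) {i : Fin m}
    (hi : x i = i) : D (left i) = right i := by
  have : i ∈ Set.range (Finset.orderEmbOfFin _ hx.2.2.2) := by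
    rw [Finset.range_orderEmbOfFin]; simpa using hi
  obtain ⟨j, rfl⟩ := this
  exact h.apply_left_eq_orderEmb hD hx hx j

lemma closure_adj {a b : Fin (2 * m)} : (closure D).Adj a b ↔ a ≠ b ∧
    ((D a = b ∨ ∃ i, a = left i ∧ b = right i) ∨ (D b = a ∨ ∃ i, b = left i ∧ a = right i)) := by
  rw [closure, SimpleGraph.fromRel_adj]

/-- The loops of the closure of `|x⟩⟨x|` correspond to the arcs and defects of `x`. -/
lemma card_closure_components (h : Joins D x x) (hD : IsPlanar 0 D) (hx : IsPlanar d x) :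
    Nat.card (closure D).ConnectedComponent = (Finset.univ.filter fun i => i ≤ x i).card := by
  have hlr (i : Fin m) : (closure D).Adj (left i) (right i) :=
    closure_adj.2 ⟨left_ne_right i i, Or.inl (Or.inr ⟨i, rfl, rfl⟩)⟩
  -- `f` labels every boundary point by the smaller end of the arc of `x` that it lies on
  set r : Fin m ⊕ Fin m → Fin m := Sum.elim (fun i => min i (x i)) (fun i => min i (x i)) with hr
  set f : Fin (2 * m) → Fin m := fun a => r ((linesEquiv m).symm a) with hf
  have fl (i : Fin m) : f (left i) = min i (x i) := by simp [hf, hr, linesEquiv_symm_left]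
  have fr (i : Fin m) : f (right i) = min i (x i) := by simp [hf, hr, linesEquiv_symm_right]
  have fD (a : Fin (2 * m)) : f (D a) = f a := by
    rcases left_or_right a with ⟨i, rfl⟩ | ⟨i, rfl⟩
    · by_cases hi : x i = i
      · rw [h.apply_left_defect hD hx hi, fl, fr]
      · rw [h.1 i hi, fl, fl, hx.1, min_comm]
    · by_cases hi : x i = i
      · rw [← h.apply_left_defect hD hx hi, hD.1, h.apply_left_defect hD hx hi, fl, fr]
      · rw [h.2.1 i hi, fr, fr, hx.1, min_comm]
  have fadj {a b : Fin (2 * m)} (hab : (closure D).Adj a b) : f a = f b := by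
    obtain ⟨-, (rfl | ⟨i, rfl, rfl⟩) | (rfl | ⟨i, rfl, rfl⟩)⟩ := closure_adj.1 hab
    · exact (fD a).symm
    · rw [fl, fr]
    · exact fD b
    · rw [fl, fr]
  have freach {a b : Fin (2 * m)} (hab : (closure D).Reachable a b) : f a = f b := by
    obtain ⟨w⟩ := hab
    induction w with
    | nil => rfl
    | cons hadj _ ih => exact (fadj hadj).trans ih
  have hsurj (i : Fin m) : ∃ j, j ≤ x j ∧ (closure D).Reachable (left j) (left i) := by
    rcases le_or_gt i (x i) with hi | hi
    · exact ⟨i, hi, .refl _⟩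
    · refine ⟨x i, by rw [hx.1]; exact hi.le, ?_⟩
      rw [← h.1 i hi.ne]
      exact (closure_adj.2 ⟨hD.ne_self _, Or.inr (Or.inl rfl)⟩).reachable
  rw [← Fintype.card_subtype, ← Nat.card_eq_fintype_card]
  symm
  refine Nat.card_eq_of_bijective
    (fun i => (closure D).connectedComponentMk (left i.1)) ⟨?_, fun c => ?_⟩
  · rintro ⟨i, hi⟩ ⟨j, hj⟩ hij
    have := freach (SimpleGraph.ConnectedComponent.eq.1 hij)
    rw [fl, fl, min_eq_left hi, min_eq_left hj] at this
    exact Subtype.ext this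
  · obtain ⟨a, rfl⟩ := c.exists_rep
    rcases left_or_right a with ⟨i, rfl⟩ | ⟨i, rfl⟩
    · obtain ⟨j, hj, hr⟩ := hsurj i
      exact ⟨⟨j, hj⟩, SimpleGraph.ConnectedComponent.eq.2 hr⟩
    · obtain ⟨j, hj, hr⟩ := hsurj i
      exact ⟨⟨j, hj⟩, SimpleGraph.ConnectedComponent.eq.2 (hr.trans (hlr i).reachable)⟩

/-- A strand joining two points of the left line is not affected by gluing. -/
lemma eq_of_glue_reachable_left (hD : ∀ a, D (D a) = a) {i j : Fin m} (hij : D (left i) = left j)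
    {b : Fin (2 * m)} (h : (glue D v).Reachable (left i) b) : b = left i ∨ b = left j := by
  have key : ∀ a b, (glue D v).Reachable a b → (a = left i ∨ a = left j) →
      (b = left i ∨ b = left j) := by
    rintro a b ⟨w⟩
    induction w with
    | nil => exact id
    | @cons a c b hadj _ ih =>
      intro ha
      refine ih ?_
      have hDa : D a = left i ∨ D a = left j := by
        rcases ha with rfl | rfl
        · exact Or.inr hij
        · exact Or.inl (by rw [← hij, hD])
      have hal (l : Fin m) : a ≠ right l := by
        rcases ha with rfl | rfl <;> exact left_ne_right _ _
      obtain ⟨-, (h1 | ⟨l, h1, -⟩) | (h1 | ⟨l, -, h1⟩)⟩ := glue_adj.1 hadj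
      · exact h1 ▸ hDa
      · exact absurd h1 (hal _)
      · rwa [← h1, hD] at hDa
      · exact absurd h1 (hal _)
  exact key _ _ h (Or.inl rfl)

/-- The fixed link states of `|x⟩⟨x|` contain the arcs of `x`. -/
lemma Joins.eq_of_isResult (h : Joins D x x) (hD : IsPlanar 0 D) (hv : IsResult D v v) {i : Fin m}
    (hi : x i ≠ i) : v i = x i := by
  by_cases hvi : v i = i
  · obtain ⟨j, -, hj⟩ := (hv i).1 hvi
    rcases eq_of_glue_reachable_left hD.1 (h.1 i hi) hj with h1 | h1 <;>
    exact absurd h1.symm (left_ne_right _ _)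
  · rcases eq_of_glue_reachable_left hD.1 (h.1 i hi) ((hv i).2 hvi) with h1 | h1
    · exact absurd (left_injective h1) hvi
    · exact left_injective h1

end closure

section trace
variable {μ j : ℕ} {D : Fin (2 * (2 * μ)) → Fin (2 * (2 * μ))} {x : Fin (2 * μ) → Fin (2 * μ)}

lemma diagramTrace_of_joins (h : Joins D x x) (hD : IsPlanar 0 D) (hx : IsPlanar (2 * j) x)
    (hj : j ≤ μ) (χ : ℝ) : diagramTrace χ D = χ ^ (μ + j) := by
  rw [diagramTrace, card_closure_components h hD hx]
  congr 1
  have e1 : (Finset.univ.filter fun i => i ≤ x i).card =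
      (Finset.univ.filter fun i => x i = i).card + (Finset.univ.filter fun i => i < x i).card := by
    rw [← Finset.card_union_of_disjoint]
    · congr 1
      ext i
      simp [le_iff_eq_or_lt, eq_comm]
    · rw [Finset.disjoint_filter]
      intro i _ h1 h2
      exact h2.ne' h1
  have e2 : (Finset.univ.filter fun i => x i ≠ i).card =
      (Finset.univ.filter fun i => x i < i).card + (Finset.univ.filter fun i => i < x i).card := by
    rw [← Finset.card_union_of_disjoint]
    · congr 1
      ext i
      simp
    · rw [Finset.disjoint_filter]
      intro i _ h1 h2
      exact lt_asymm h1 h2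
  have e3 : (Finset.univ.filter fun i => x i < i).card =
      (Finset.univ.filter fun i => i < x i).card := by
    refine Finset.card_nbij' x x ?_ ?_ ?_ ?_
    · intro i hi
      have hi : x i < i := by simpa using hi
      exact Finset.mem_coe.2 (Finset.mem_filter.2 ⟨Finset.mem_univ _, by rwa [hx.1]⟩)
    · intro i hi
      have hi : i < x i := by simpa using hi
      exact Finset.mem_coe.2 (Finset.mem_filter.2 ⟨Finset.mem_univ _, by rwa [hx.1]⟩)
    · intro i _; exact hx.1 i
    · intro i _; exact hx.1 i
  rw [hx.card_not_defect] at e2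
  rw [hx.2.2.2] at e1
  omega

lemma trace_stdRep (χ : ℝ) (k : ℕ) : (stdRep k χ D).trace =
    ∑ v : LinkState (2 * μ) k, open Classical in
      if IsResult D v.1 v.1 then χ ^ loops D v.1 else 0 :=
  rfl

lemma Joins.loops_le (h : Joins D x x) (hD : IsPlanar 0 D) (hx : IsPlanar (2 * j) x)
    (v : Fin (2 * μ) → Fin (2 * μ)) : loops D v ≤ μ - j := by
  have h1 := two_mul_loops_le_diagram (v := v) hD.1 hD.ne_self
  have h2 : (Finset.univ.filter fun i => ∃ j, D (right i) = right j).card ≤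
      (Finset.univ.filter fun i => x i ≠ i).card := by
    refine Finset.card_le_card (Finset.monotone_filter_right _ fun i _ hi hxi => ?_)
    obtain ⟨l, hl⟩ := hi
    rw [← h.apply_left_defect hD hx hxi, hD.1] at hl
    exact left_ne_right _ _ hl
  rw [hx.card_not_defect] at h2
  omega

lemma Joins.defects_subset (h : Joins D x x) (hD : IsPlanar 0 D) {v : Fin (2 * μ) → Fin (2 * μ)}
    (hv : IsResult D v v) : (Finset.univ.filter fun i => v i = i) ⊆
      Finset.univ.filter fun i => x i = i := by
  refine Finset.monotone_filter_right _ fun i _ hi => ?_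
  by_contra hxi
  exact hxi (by rw [← h.eq_of_isResult hD hv hxi]; exact hi)

lemma trace_stdRep_of_gt (h : Joins D x x) (hD : IsPlanar 0 D) (hx : IsPlanar (2 * j) x) {k : ℕ}
    (hjk : j < k) (χ : ℝ) : (stdRep k χ D).trace = 0 := by
  rw [trace_stdRep]
  refine Finset.sum_eq_zero fun v _ => if_neg fun hv => ?_
  have := Finset.card_le_card (h.defects_subset hD hv)
  rw [v.2.2.2.2, hx.2.2.2] at this
  omega

lemma trace_stdRep_self (h : Joins D x x) (hD : IsPlanar 0 D) (hx : IsPlanar (2 * j) x) (χ : ℝ) :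
    (stdRep j χ D).trace = χ ^ (μ - j) := by
  have hxx := (isResult_and_loops_iff_joins hx.1 hD.1 hD.ne_self).2 h
  rw [hx.card_not_defect] at hxx
  rw [trace_stdRep, Finset.sum_eq_single ⟨x, hx⟩]
  · rw [if_pos hxx.1]
    congr 1
    change loops D x = μ - j
    omega
  · intro v _ hvx
    refine if_neg fun hv => hvx (Subtype.ext (funext fun i => ?_))
    have := Finset.eq_of_subset_of_card_le (h.defects_subset hD hv)
      (by rw [v.2.2.2.2, hx.2.2.2])
    by_cases hi : x i = i
    · have hmem : i ∈ Finset.univ.filter fun i => x i = i := by simpa using hi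
      rw [← this] at hmem
      exact (Finset.mem_filter.1 hmem).2.trans hi.symm
    · exact h.eq_of_isResult hD hv hi
  · exact fun h => absurd (Finset.mem_univ _) h

lemma abs_trace_stdRep_le (h : Joins D x x) (hD : IsPlanar 0 D) (hx : IsPlanar (2 * j) x) (k : ℕ)
    {χ : ℝ} (hχ : 1 ≤ χ) :
    |(stdRep k χ D).trace| ≤ Fintype.card (LinkState (2 * μ) k) * χ ^ (μ - j) := by
  rw [trace_stdRep, ← nsmul_eq_mul, ← Finset.card_univ]
  refine (Finset.abs_sum_le_sum_abs _ _).trans (Finset.sum_le_card_nsmul _ _ _ fun v _ => ?_)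
  split_ifs
  · rw [abs_of_nonneg (by positivity)]
    exact pow_le_pow_right₀ hχ (h.loops_le hD hx _)
  · rw [abs_zero]; positivity

end trace

/-- Evaluating the trace identity on `|x⟩⟨x|` gives a triangular system for the multiplicities,
which is solved to leading order by `χ ^ (2 * j)`. -/
lemma tendsto_multiplicity (μ : ℕ) (d : ℝ → ℕ → ℝ)
    (hd : ∀ᶠ χ : ℝ in atTop, IsMultiplicity (2 * μ) χ (d χ)) (j : ℕ) (hj : j ≤ μ) :
    Tendsto (fun χ : ℝ => d χ j / χ ^ (2 * j)) atTop (𝓝 1) := by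
  induction j using Nat.strong_induction_on with
  | _ j ih =>
    obtain ⟨x, hx⟩ := exists_isPlanar hj
    obtain ⟨D, hD, h⟩ := exists_joins hx hx
    have hterm : ∀ i ∈ Finset.range j, Tendsto (fun χ : ℝ => d χ i / χ ^ (2 * i) *
        ((stdRep i χ D).trace / χ ^ (μ - j) * (χ ^ (2 * i) / χ ^ (2 * j)))) atTop (𝓝 0) := by
      intro i hi
      rw [Finset.mem_range] at hi
      rw [← mul_zero (1 : ℝ)]
      refine (ih i hi (by omega)).mul ?_
      refine squeeze_zero_norm' (a := fun χ : ℝ => Fintype.card (LinkState (2 * μ) i) * χ⁻¹) ?_ ?_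
      · filter_upwards [eventually_ge_atTop 1] with χ hχ
        have h0 : 0 < χ := by linarith
        have h1 := abs_trace_stdRep_le h hD hx i hχ
        have h2 : χ ^ (2 * i) / χ ^ (2 * j) ≤ χ⁻¹ := by
          rw [div_le_iff₀ (by positivity), show 2 * j = (2 * j - 1) + 1 by omega,
            pow_succ', inv_mul_cancel_left₀ h0.ne']
          exact pow_le_pow_right₀ hχ (by omega)
        rw [norm_mul, norm_div, norm_div, Real.norm_eq_abs, Real.norm_of_nonneg (by positivity),
          Real.norm_of_nonneg (by positivity), Real.norm_of_nonneg (by positivity)]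
        refine mul_le_mul ?_ h2 (by positivity) (by positivity)
        rwa [div_le_iff₀ (by positivity)]
      · simpa using (tendsto_inv_atTop_zero (𝕜 := ℝ)).const_mul
          (Fintype.card (LinkState (2 * μ) i) : ℝ)
    have hlim := (tendsto_const_nhds (x := (1 : ℝ))).sub (tendsto_finsetSum _ hterm)
    rw [Finset.sum_const_zero, sub_zero] at hlim
    refine hlim.congr' ?_
    filter_upwards [hd, eventually_gt_atTop 0] with χ hd h0
    have e := hd ⟨D, hD⟩
    simp only at e
    rw [diagramTrace_of_joins h hD hx hj, show 2 * μ / 2 + 1 = (j + 1) + (μ - j) by omega,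
      Finset.sum_range_add, Finset.sum_range_succ, trace_stdRep_self h hD hx,
      Finset.sum_eq_zero (s := Finset.range (μ - j)) fun i _ => by
        rw [trace_stdRep_of_gt h hD hx (by omega), mul_zero], add_zero] at e
    have e2 : d χ j / χ ^ (2 * j) = (d χ j * χ ^ (μ - j)) / χ ^ (μ + j) := by
      rw [show μ + j = 2 * j + (μ - j) by omega, pow_add]
      field_simp
    rw [e2, ← sub_eq_iff_eq_add'.2 e, sub_div, div_self (by positivity), Finset.sum_div]
    congr 1
    refine Finset.sum_congr rfl fun i _ => ?_
    rw [show μ + j = 2 * j + (μ - j) by omega, pow_add]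
    field_simp

/-! ### The leading order of the matrices `M` -/

/-- Up to order `χ⁻¹`, the matrix `χ ^ (k - μ) • M` is of rank one: the leading order of the entry
`(x, y)` comes from `|x⟩⟨y|` only, and the number of cycles is additive in the two halves. -/
lemma abs_M_sub_le {μ k : ℕ} {q : ℝ} (hq : 0 < q) {χ : ℝ} (hχ : 1 ≤ χ)
    (x y : LinkState (2 * μ) k) :
    |M (2 * μ) k χ q x y - χ ^ (μ - k) * q⁻¹ ^ (k + oddClosings x.1 + oddClosings y.1)| ≤
      (∑ h : Equiv.Perm (Fin (2 * μ)), q⁻¹ ^ numCycles h) * (χ ^ (μ - k) * χ⁻¹) := by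
  classical
  have h0 : 0 < χ := by linarith
  obtain ⟨h₀, ⟨hnc, hj⟩, huniq⟩ := existsUnique_noncrossing_joins x.2 y.2
  have hent : M (2 * μ) k χ q x y = ∑ h : Equiv.Perm (Fin (2 * μ)), if IsNoncrossing h then
      q⁻¹ ^ numCycles h *
        (if IsResult (doubleLine h) y.1 x.1 then χ ^ loops (doubleLine h) y.1 else 0) else 0 := by
    rw [M, Matrix.sum_apply, Finset.sum_filter]
    refine Finset.sum_congr rfl fun h _ => ?_
    by_cases h1 : IsNoncrossing h
    · rw [if_pos h1, if_pos h1]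
      rfl
    · rw [if_neg h1, if_neg h1]
  have hres := fun h : Equiv.Perm (Fin (2 * μ)) => isResult_and_loops_iff_joins (x := x.1) y.2.1
    (doubleLine_doubleLine h) (doubleLine_ne_self h)
  have hcard := y.2.card_not_defect
  have h1 := (hres h₀).2 hj
  rw [hent, ← Finset.add_sum_erase _ _ (Finset.mem_univ h₀), if_pos hnc, if_pos h1.1,
    hj.numCycles_eq hnc x.2 y.2, show loops (doubleLine h₀) y.1 = μ - k by omega,
    mul_comm (χ ^ (μ - k)), add_sub_cancel_left, Finset.sum_mul]
  refine (Finset.abs_sum_le_sum_abs _ _).trans ?_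
  refine (Finset.sum_le_sum fun h hh => ?_).trans
    (Finset.sum_le_sum_of_subset_of_nonneg (Finset.erase_subset h₀ _) fun _ _ _ => by positivity)
  have hne := Finset.ne_of_mem_erase hh
  split_ifs with h2 h3
  · rw [abs_of_nonneg (by positivity)]
    refine mul_le_mul_of_nonneg_left ?_ (by positivity)
    have h4 := two_mul_loops_le (D := doubleLine h) y.2.1
    have h5 : 2 * loops (doubleLine h) y.1 ≠
        (Finset.univ.filter fun i => y.1 i ≠ i).card := fun h5 =>
      hne (huniq h ⟨h2, (hres h).1 ⟨h3, h5⟩⟩)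
    rw [show μ - k = (μ - k - 1) + 1 by omega, pow_succ, mul_assoc, mul_inv_cancel₀ h0.ne', mul_one]
    exact pow_le_pow_right₀ hχ (by omega)
  · rw [mul_zero, abs_zero]; positivity
  · rw [abs_zero]; positivity

open Matrix in
/-- The matrix `M` as a perturbation of a rank one matrix; the factor `q⁻¹ ^ k` is put into the
second vector. -/
lemma exists_M_eq (μ k : ℕ) {q : ℝ} (hq : 0 < q) : ∃ (A : ℝ → Matrix (LinkState (2 * μ) k)
    (LinkState (2 * μ) k) ℝ) (K : ℝ), ∀ χ : ℝ, 1 ≤ χ → (∀ x y, |A χ x y| ≤ K) ∧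
      M (2 * μ) k χ q = χ ^ (μ - k) • (vecMulVec (fun x => q⁻¹ ^ oddClosings x.1)
        (fun y => q⁻¹ ^ k * q⁻¹ ^ oddClosings y.1) + χ⁻¹ • A χ) := by
  refine ⟨fun χ => χ • ((χ ^ (μ - k))⁻¹ • M (2 * μ) k χ q -
    vecMulVec (fun x => q⁻¹ ^ oddClosings x.1) (fun y => q⁻¹ ^ k * q⁻¹ ^ oddClosings y.1)),
    ∑ h : Equiv.Perm (Fin (2 * μ)), q⁻¹ ^ numCycles h, fun χ hχ => ⟨fun x y => ?_, ?_⟩⟩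
  · have h0 : 0 < χ := by linarith
    have := abs_M_sub_le hq hχ x y
    have e : (χ • ((χ ^ (μ - k))⁻¹ • M (2 * μ) k χ q - vecMulVec
        (fun x : LinkState (2 * μ) k => q⁻¹ ^ oddClosings x.1)
        (fun y : LinkState (2 * μ) k => q⁻¹ ^ k * q⁻¹ ^ oddClosings y.1))) x y =
        (χ ^ (μ - k) * χ⁻¹)⁻¹ *
        (M (2 * μ) k χ q x y - χ ^ (μ - k) * q⁻¹ ^ (k + oddClosings x.1 + oddClosings y.1)) := by
      simp only [Matrix.smul_apply, Matrix.sub_apply, vecMulVec_apply, smul_eq_mul, pow_add]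
      field_simp
    beta_reduce
    rw [e, abs_mul, abs_of_pos (by positivity), inv_mul_le_iff₀ (by positivity),
      mul_comm _ (∑ _, _)]
    exact this
  · have h0 : χ ≠ 0 := by linarith
    rw [smul_smul χ⁻¹, inv_mul_cancel₀ h0, one_smul, add_sub_cancel, smul_smul,
      mul_inv_cancel₀ (pow_ne_zero _ h0), one_smul]

end TL

theorem mainTheorem3 (μ k : ℕ) (hk : k ≤ μ) (qA qB : ℝ) (hA : 0 < qA) (hB : 0 < qB)
    (N : ℝ → Matrix (TL.LinkState (2 * μ) k) (TL.LinkState (2 * μ) k) ℝ)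
    (hN : ∀ χ, N χ = TL.M (2 * μ) k χ qA * TL.M (2 * μ) k χ qB)
    (Λ : ℝ) (hΛ : Λ = ((qA * qB) ^ k)⁻¹ * TL.g μ k (qA * qB)⁻¹ ^ 2) :
    -- the rescaled matrices converge to a matrix of rank one with nonzero eigenvalue `Λ`
    Λ ≠ 0 ∧
    (∃ R : Matrix (TL.LinkState (2 * μ) k) (TL.LinkState (2 * μ) k) ℝ,
      Tendsto (fun χ : ℝ => (χ ^ (2 * μ - 2 * k))⁻¹ • N χ) atTop (𝓝 R) ∧
      R.rank = 1 ∧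
      R.charpoly = Polynomial.X ^ (Fintype.card (TL.LinkState (2 * μ) k) - 1) *
        (Polynomial.X - Polynomial.C Λ)) ∧
    -- one simple eigenvalue is asymptotic to `Λ χ ^ (m - 2 k)`, the others are suppressed
    (∃ (lam : ℝ → ℝ) (K : ℝ),
      Tendsto (fun χ : ℝ => lam χ / χ ^ (2 * μ - 2 * k)) atTop (𝓝 Λ) ∧
      ∀ᶠ χ : ℝ in atTop,
        ((N χ).charpoly.map (algebraMap ℝ ℂ)).rootMultiplicity (lam χ : ℂ) = 1 ∧
        ∀ z : ℂ, ((N χ).charpoly.map (algebraMap ℝ ℂ)).IsRoot z → z ≠ (lam χ : ℂ) →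
          ‖z‖ ≤ K * χ ^ (2 * μ - 2 * k) / χ ^ 2) ∧
    -- the multiplicity of the sector
    (∀ d : ℝ → ℕ → ℝ, (∀ᶠ χ : ℝ in atTop, TL.IsMultiplicity (2 * μ) χ (d χ)) →
      Tendsto (fun χ : ℝ => d χ k / χ ^ (2 * k)) atTop (𝓝 1)) := by
  have hQ : (0 : ℝ) < (qA * qB)⁻¹ := by positivity
  have hΛ0 : Λ ≠ 0 := by
    have := TL.g_pos hQ hk
    rw [hΛ]; positivity
  obtain ⟨A, KA, hMA⟩ := TL.exists_M_eq μ k hA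
  obtain ⟨B, KB, hMB⟩ := TL.exists_M_eq μ k hB
  have hdot : ∑ x : TL.LinkState (2 * μ) k, qA⁻¹ ^ TL.oddClosings x.1 * qB⁻¹ ^ TL.oddClosings x.1 =
      TL.g μ k (qA * qB)⁻¹ := by
    rw [← TL.sum_linkState_eq_g hQ.ne']
    refine Finset.sum_congr rfl fun x _ => ?_
    rw [← mul_pow, mul_inv]
  obtain ⟨h1, h2⟩ := TL.spectrum_of_rank_one_perturbation
    (fun x : TL.LinkState (2 * μ) k => qA⁻¹ ^ TL.oddClosings x.1)
    (fun y => qA⁻¹ ^ k * qA⁻¹ ^ TL.oddClosings y.1)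
    (fun x => qB⁻¹ ^ TL.oddClosings x.1)
    (fun y => qB⁻¹ ^ k * qB⁻¹ ^ TL.oddClosings y.1) Λ
    (by
      have e1 : (fun y : TL.LinkState (2 * μ) k => qA⁻¹ ^ k * qA⁻¹ ^ TL.oddClosings y.1) ⬝ᵥ
          (fun x => qB⁻¹ ^ TL.oddClosings x.1) = qA⁻¹ ^ k * TL.g μ k (qA * qB)⁻¹ := by
        rw [← hdot, dotProduct, Finset.mul_sum]
        exact Finset.sum_congr rfl fun x _ => by ring
      have e2 : (fun y : TL.LinkState (2 * μ) k => qB⁻¹ ^ k * qB⁻¹ ^ TL.oddClosings y.1) ⬝ᵥ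
          (fun x => qA⁻¹ ^ TL.oddClosings x.1) = qB⁻¹ ^ k * TL.g μ k (qA * qB)⁻¹ := by
        rw [← hdot, dotProduct, Finset.mul_sum]
        exact Finset.sum_congr rfl fun x _ => by ring
      rw [e1, e2, hΛ, mul_pow, mul_inv, inv_pow, inv_pow]
      ring)
    hΛ0 (2 * μ - 2 * k) (max KA KB) N A B
    (by
      filter_upwards [eventually_ge_atTop 1] with χ hχ
      rw [hN, (hMA χ hχ).2, (hMB χ hχ).2, smul_mul_smul_comm, ← pow_add]
      congr 2
      omega)
    (by
      filter_upwards [eventually_ge_atTop 1] with χ hχ i j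
      exact ((hMA χ hχ).1 i j).trans (le_max_left _ _))
    (by
      filter_upwards [eventually_ge_atTop 1] with χ hχ i j
      exact ((hMB χ hχ).1 i j).trans (le_max_right _ _))
  exact ⟨hΛ0, h1, h2, fun d hd => TL.tendsto_multiplicity μ d hd k hk⟩
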